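/- Let $1<p<\infty$. For an open set $U\subset\mathbb{R}^2$ let $X_p(U)=W^{2,p}(U)\cap W^{1,p}_0(U)$ with the $W^{2,p}$ norm. Let $\Omega\subset\mathbb{R}^2$ be bounded, open and connected, and let $\phi\colon\Omega\to\tilde\Omega$ be a homeomorphism onto an open set $\tilde\Omega\subset\mathbb{R}^2$. Call $\phi$ *$p$-admissible* if it has essentially bounded weak derivatives of first and second order, $\inf_\Omega|\det D\phi|>0$, and the Laplacian $\Delta\colon X_p\to L^p$ is invertible (with bounded inverse) on both $\Omega$ and $\tilde\Omega$. In that case put $$T=\Delta_\Omega^{-1}\colon L^p(\Omega)\to X_p(\Omega)\hookrightarrow L^p(\Omega),\qquad T_\phi=C_\phi\circ\Delta_{\tilde\Omega}^{-1}\circ C_{\phi^{-1}}\colon L^p(\Omega)\to L^p(\Omega),$$ where $C_\phi v=v\circ\phi$ and $C_{\phi^{-1}}u=u\circ\phi^{-1}$; the composition operators are bounded between $L^p(\tilde\Omega)$ and $L^p(\Omega)$. Suppose that $\phi\colon\Omega\to\tilde\Omega$ is $p$-admissible, and differentiable and conformal (angle-preserving) at every point of $\Omega$. Then $$\|T-T_\phi\|_{L^p(\Omega)\to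 L^p(\Omega)}\le C\,\frac{\big\|1-|\det D\phi|\big\|_{L^\infty(\Omega)}}{\inf_\Omega|\det D\phi|},$$ where 1. $C$ can be chosen depending only on $p$ and $\tilde\Omega$ (not on $\Omega$ or $\phi$); and 2. for every $M<\infty$, $C$ can be chosen depending only on $p$, $\Omega$ and $M$ for all such $\phi$ (with arbitrary image $\tilde\Omega$) that satisfy $\inf_\Omega|\det D\phi|\le M$. -/

import Mathlib

open MeasureTheory Set
open scoped ENNReal NNReal ContDiff

noncomputable section

namespace PlaneDomain

/-- The Euclidean plane `ℝ²`. -/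
abbrev Plane : Type := EuclideanSpace ℝ (Fin 2)

/-- `ψ ∈ C_c^∞(Ω)`. -/
structure IsTestFunction (Ω : Set Plane) (ψ : Plane → ℝ) : Prop where
  smooth : ContDiff ℝ ∞ ψ
  compact : HasCompactSupport ψ
  support : tsupport ψ ⊆ Ω

/-- The classical partial derivative `∂ᵢ ψ`. -/
def partialDeriv (i : Fin 2) (ψ : Plane → ℝ) (x : Plane) : ℝ :=
  fderiv ℝ ψ x (EuclideanSpace.single i 1)

/-- `g = ∂ᵢ u` on `Ω` in the weak (distributional) sense. -/
structure IsWeakPartial (Ω : Set Plane) (i : Fin 2) (u g : Plane → ℝ) : Prop where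
  locInt : LocallyIntegrableOn u Ω
  locInt_deriv : LocallyIntegrableOn g Ω
  integral_eq : ∀ ψ : Plane → ℝ, IsTestFunction Ω ψ →
    ∫ x in Ω, partialDeriv i ψ x * u x = - ∫ x in Ω, ψ x * g x

/-- `L^p(Ω)`. -/
abbrev LpSpace (p : ℝ≥0∞) (Ω : Set Plane) : Type := Lp ℝ p (volume.restrict Ω)

variable {Ω : Set Plane} {p : ℝ≥0∞}

theorem IsTestFunction.zero : IsTestFunction Ω (fun _ => 0) :=
  ⟨contDiff_const, HasCompactSupport.zero, by simp [tsupport]⟩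

theorem IsTestFunction.add {ψ χ : Plane → ℝ} (h : IsTestFunction Ω ψ)
    (h' : IsTestFunction Ω χ) : IsTestFunction Ω (fun x => ψ x + χ x) :=
  ⟨h.smooth.add h'.smooth, h.compact.add h'.compact,
    (tsupport_add ψ χ).trans (union_subset h.support h'.support)⟩

theorem IsTestFunction.const_mul {ψ : Plane → ℝ} (c : ℝ) (h : IsTestFunction Ω ψ) :
    IsTestFunction Ω (fun x => c * ψ x) :=
  ⟨contDiff_const.mul h.smooth, h.compact.mul_left,
    (tsupport_mul_subset_right).trans h.support⟩

theorem partialDeriv_add {ψ χ : Plane → ℝ} (i : Fin 2) (h : IsTestFunction Ω ψ)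
    (h' : IsTestFunction Ω χ) (x : Plane) :
    partialDeriv i (fun x => ψ x + χ x) x = partialDeriv i ψ x + partialDeriv i χ x := by
  have h1 := (h.smooth.differentiable (by simp)) x
  have h2 := (h'.smooth.differentiable (by simp)) x
  simp only [partialDeriv]
  rw [fderiv_fun_add h1 h2]; rfl

theorem partialDeriv_const_mul {ψ : Plane → ℝ} (i : Fin 2) (c : ℝ) (h : IsTestFunction Ω ψ)
    (x : Plane) : partialDeriv i (fun x => c * ψ x) x = c * partialDeriv i ψ x := by
  have h1 := (h.smooth.differentiable (by simp)) x
  simp only [partialDeriv]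
  rw [fderiv_const_mul h1]; rfl

/-- A continuous function supported in a compact subset of `Ω` times a locally integrable one. -/
theorem integrableOn_mul {η u : Plane → ℝ} (hc : Continuous η) (hs : HasCompactSupport η)
    (ht : tsupport η ⊆ Ω) (hu : LocallyIntegrableOn u Ω) :
    IntegrableOn (fun x => η x * u x) Ω := by
  have hK : IntegrableOn u (tsupport η) := hu.integrableOn_compact_subset ht hs
  have h1 : IntegrableOn (fun x => η x * u x) (tsupport η) :=
    hK.continuousOn_mul hc.continuousOn hs
  have h2 : Integrable (fun x => η x * u x) :=
    (integrableOn_iff_integrable_of_support_subset (fun x hx => subset_tsupport η (by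
      intro h0; apply hx; simp [h0]))).1 h1
  exact h2.integrableOn

theorem IsTestFunction.integrableOn_mul {ψ u : Plane → ℝ} (h : IsTestFunction Ω ψ)
    (hu : LocallyIntegrableOn u Ω) : IntegrableOn (fun x => ψ x * u x) Ω :=
  PlaneDomain.integrableOn_mul h.smooth.continuous h.compact h.support hu

theorem IsTestFunction.integrableOn_partial_mul {ψ u : Plane → ℝ} (i : Fin 2)
    (h : IsTestFunction Ω ψ) (hu : LocallyIntegrableOn u Ω) :
    IntegrableOn (fun x => partialDeriv i ψ x * u x) Ω :=
  PlaneDomain.integrableOn_mul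
    ((h.smooth.continuous_fderiv (by simp)).clm_apply continuous_const)
    (h.compact.fderiv_apply (𝕜 := ℝ) _)
    ((tsupport_fderiv_apply_subset ℝ _).trans h.support) hu

theorem IsWeakPartial.zero (i : Fin 2) : IsWeakPartial Ω i (fun _ => 0) (fun _ => 0) :=
  ⟨locallyIntegrableOn_zero, locallyIntegrableOn_zero, by simp⟩

theorem IsWeakPartial.add {i : Fin 2} {u g u' g' : Plane → ℝ} (h : IsWeakPartial Ω i u g)
    (h' : IsWeakPartial Ω i u' g') :
    IsWeakPartial Ω i (fun x => u x + u' x) (fun x => g x + g' x) := by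
  refine ⟨h.locInt.add h'.locInt, h.locInt_deriv.add h'.locInt_deriv, fun ψ hψ => ?_⟩
  simp only [mul_add]
  rw [integral_add (hψ.integrableOn_partial_mul i h.locInt)
      (hψ.integrableOn_partial_mul i h'.locInt),
    integral_add (hψ.integrableOn_mul h.locInt_deriv) (hψ.integrableOn_mul h'.locInt_deriv),
    h.integral_eq ψ hψ, h'.integral_eq ψ hψ]
  ring

theorem IsWeakPartial.const_mul {i : Fin 2} {u g : Plane → ℝ} (c : ℝ)
    (h : IsWeakPartial Ω i u g) :
    IsWeakPartial Ω i (fun x => c * u x) (fun x => c * g x) := by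
  refine ⟨h.locInt.smul c, h.locInt_deriv.smul c, fun ψ hψ => ?_⟩
  simp only [mul_left_comm _ c]
  rw [integral_const_mul, integral_const_mul, h.integral_eq ψ hψ, mul_neg]

theorem IsWeakPartial.congr {i : Fin 2} {u g u' g' : Plane → ℝ} (h : IsWeakPartial Ω i u g)
    (hu : u =ᵐ[volume.restrict Ω] u') (hg : g =ᵐ[volume.restrict Ω] g') :
    IsWeakPartial Ω i u' g' := by
  refine ⟨LocallyIntegrableOn.congr hu h.locInt,
    LocallyIntegrableOn.congr hg h.locInt_deriv, fun ψ hψ => ?_⟩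
  have e1 : ∫ x in Ω, partialDeriv i ψ x * u' x = ∫ x in Ω, partialDeriv i ψ x * u x :=
    integral_congr_ae (hu.mono fun x hx => by simp only [hx])
  have e2 : ∫ x in Ω, ψ x * g' x = ∫ x in Ω, ψ x * g x :=
    integral_congr_ae (hg.mono fun x hx => by simp only [hx])
  rw [e1, e2, h.integral_eq ψ hψ]

variable [Fact (1 ≤ p)]

/-- `W^{2,p}(Ω)`, as the space of triples `(u, Du, D²u)` of a function in `L^p(Ω)` and its weak
derivatives in `L^p(Ω)` of orders one and two: `z.2.1 i = ∂ᵢ u` and `z.2.2 i j = ∂ⱼ ∂ᵢ u`.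
The triple is determined by `u`. The norm is the maximum of the `L^p` norms of the entries, which
is equivalent to the `W^{2,p}` norm. -/
def W2p (p : ℝ≥0∞) [Fact (1 ≤ p)] (Ω : Set Plane) :
    Submodule ℝ (LpSpace p Ω × (Fin 2 → LpSpace p Ω) × (Fin 2 → Fin 2 → LpSpace p Ω)) where
  carrier := {z | (∀ i, IsWeakPartial Ω i (z.1 : Plane → ℝ) (z.2.1 i : Plane → ℝ)) ∧
    ∀ i j, IsWeakPartial Ω j (z.2.1 i : Plane → ℝ) (z.2.2 i j : Plane → ℝ)}
  zero_mem' := ⟨fun i => (IsWeakPartial.zero i).congr (Lp.coeFn_zero _ _ _).symm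
      (Lp.coeFn_zero _ _ _).symm,
    fun _ j => (IsWeakPartial.zero j).congr (Lp.coeFn_zero _ _ _).symm
      (Lp.coeFn_zero _ _ _).symm⟩
  add_mem' := fun {_ _} ha hb =>
    ⟨fun i => ((ha.1 i).add (hb.1 i)).congr (Lp.coeFn_add _ _).symm (Lp.coeFn_add _ _).symm,
    fun i j => ((ha.2 i j).add (hb.2 i j)).congr (Lp.coeFn_add _ _).symm
      (Lp.coeFn_add _ _).symm⟩
  smul_mem' := fun c _ ha =>
    ⟨fun i => ((ha.1 i).const_mul c).congr (Lp.coeFn_smul c _).symm (Lp.coeFn_smul c _).symm,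
    fun i j => ((ha.2 i j).const_mul c).congr (Lp.coeFn_smul c _).symm
      (Lp.coeFn_smul c _).symm⟩

/-- The test functions on `Ω`, as pairs `(ψ, Dψ)` in `L^p(Ω) × L^p(Ω)²`. -/
def testPairs (p : ℝ≥0∞) [Fact (1 ≤ p)] (Ω : Set Plane) :
    Submodule ℝ (LpSpace p Ω × (Fin 2 → LpSpace p Ω)) where
  carrier := {z | ∃ ψ : Plane → ℝ, IsTestFunction Ω ψ ∧ z.1 =ᵐ[volume.restrict Ω] ψ ∧
    ∀ i, z.2 i =ᵐ[volume.restrict Ω] partialDeriv i ψ}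
  zero_mem' := ⟨fun _ => 0, .zero, Lp.coeFn_zero _ _ _, fun i => by
    have : partialDeriv i (fun _ => 0) = 0 := by ext x; simp [partialDeriv]
    rw [this]; exact Lp.coeFn_zero _ _ _⟩
  add_mem' := by
    rintro a b ⟨ψ, hψ, h1, h2⟩ ⟨χ, hχ, h3, h4⟩
    refine ⟨_, hψ.add hχ, (Lp.coeFn_add _ _).trans (h1.add h3), fun i => ?_⟩
    refine (Lp.coeFn_add _ _).trans (((h2 i).add (h4 i)).trans (.of_forall fun x => ?_))
    exact (partialDeriv_add i hψ hχ x).symm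
  smul_mem' := by
    rintro c a ⟨ψ, hψ, h1, h2⟩
    refine ⟨_, hψ.const_mul c, (Lp.coeFn_smul c _).trans (h1.const_smul c), fun i => ?_⟩
    refine (Lp.coeFn_smul c _).trans (((h2 i).const_smul c).trans (.of_forall fun x => ?_))
    exact (partialDeriv_const_mul i c hψ x).symm

/-- `W_0^{1,p}(Ω)`, the closure of `C_c^∞(Ω)` in the `W^{1,p}` norm, as a space of pairs
`(u, Du)`. -/
def W01p (p : ℝ≥0∞) [Fact (1 ≤ p)] (Ω : Set Plane) :
    Submodule ℝ (LpSpace p Ω × (Fin 2 → LpSpace p Ω)) :=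
  (testPairs p Ω).topologicalClosure

/-- `X_p(Ω) = W^{2,p}(Ω) ∩ W_0^{1,p}(Ω)` with the `W^{2,p}` norm. -/
def Xp (p : ℝ≥0∞) [Fact (1 ≤ p)] (Ω : Set Plane) :
    Submodule ℝ (LpSpace p Ω × (Fin 2 → LpSpace p Ω) × (Fin 2 → Fin 2 → LpSpace p Ω)) :=
  W2p p Ω ⊓ (W01p p Ω).comap
    ((LinearMap.id : LpSpace p Ω →ₗ[ℝ] LpSpace p Ω).prodMap
      (LinearMap.fst ℝ (Fin 2 → LpSpace p Ω) (Fin 2 → Fin 2 → LpSpace p Ω)))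

/-- The inclusion `X_p(Ω) ↪ L^p(Ω)`, `(u, Du, D²u) ↦ u`. -/
def inclusion (p : ℝ≥0∞) [Fact (1 ≤ p)] (Ω : Set Plane) : Xp p Ω →L[ℝ] LpSpace p Ω :=
  (ContinuousLinearMap.fst ℝ _ _).comp (Xp p Ω).subtypeL

/-- The second derivative `∂ⱼ ∂ᵢ : X_p(Ω) → L^p(Ω)`. -/
def secondDeriv (p : ℝ≥0∞) [Fact (1 ≤ p)] (Ω : Set Plane) (i j : Fin 2) :
    Xp p Ω →L[ℝ] LpSpace p Ω :=
  (ContinuousLinearMap.proj (R := ℝ) (φ := fun _ : Fin 2 => LpSpace p Ω) j).comp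
    ((ContinuousLinearMap.proj (R := ℝ) (φ := fun _ : Fin 2 => Fin 2 → LpSpace p Ω) i).comp
      ((ContinuousLinearMap.snd ℝ _ _).comp
        ((ContinuousLinearMap.snd ℝ _ _).comp (Xp p Ω).subtypeL)))

/-- The Dirichlet Laplacian `Δ : X_p(Ω) → L^p(Ω)`. -/
def laplacian (p : ℝ≥0∞) [Fact (1 ≤ p)] (Ω : Set Plane) : Xp p Ω →L[ℝ] LpSpace p Ω :=
  ∑ i, secondDeriv p Ω i i

/-- `Δ⁻¹ : L^p(Ω) → X_p(Ω) ↪ L^p(Ω)` (meaningful when `Δ` is invertible). -/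
def inverseLaplacian (p : ℝ≥0∞) [Fact (1 ≤ p)] (Ω : Set Plane) :
    LpSpace p Ω →L[ℝ] LpSpace p Ω :=
  (inclusion p Ω).comp (laplacian p Ω).inverse

/-- The triple `(Ω, φ, Ω')` is `p`-admissible: `φ` is a homeomorphism of `Ω` onto `Ω'` with
bounded weak derivatives `D k i = ∂ᵢ φₖ` and `H k i j = ∂ⱼ ∂ᵢ φₖ` of orders one and two,
the (essential) infimum of `|det Dφ|` is positive, and `Δ : X_p → L^p` is invertible on both
`Ω` and `Ω'`. -/
structure IsAdmissible (p : ℝ≥0∞) [Fact (1 ≤ p)] (Ω : Set Plane)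
    (φ : OpenPartialHomeomorph Plane Plane) (Ω' : Set Plane) : Prop where
  source_eq : φ.source = Ω
  target_eq : φ.target = Ω'
  exists_weakDeriv : ∃ (D : Fin 2 → Fin 2 → Plane → ℝ) (H : Fin 2 → Fin 2 → Fin 2 → Plane → ℝ),
    (∀ k i, IsWeakPartial Ω i (fun x => φ x k) (D k i)) ∧
    (∀ k i j, IsWeakPartial Ω j (D k i) (H k i j)) ∧
    (∀ k i, MemLp (D k i) ∞ (volume.restrict Ω)) ∧
    (∀ k i j, MemLp (H k i j) ∞ (volume.restrict Ω)) ∧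
    ∃ c : ℝ, 0 < c ∧
      ∀ᵐ x ∂(volume.restrict Ω), c ≤ |(Matrix.of fun k i => D k i x).det|
  invertible_source : (laplacian p Ω).IsInvertible
  invertible_target : (laplacian p Ω').IsInvertible

/-- `S : L^p(Ω') → L^p(Ω)` is the composition operator `C_φ : v ↦ v ∘ φ`. -/
def IsCompositionOperator {p : ℝ≥0∞} [Fact (1 ≤ p)] {Ω Ω' : Set Plane} (φ : Plane → Plane)
    (S : LpSpace p Ω' →L[ℝ] LpSpace p Ω) : Prop :=
  ∀ v : LpSpace p Ω', S v =ᵐ[volume.restrict Ω] fun x => v (φ x)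

/-- `|det Dφ(x)|`. -/
def absJac (φ : Plane → Plane) (x : Plane) : ℝ := |(fderiv ℝ φ x).det|

/-- With `T = Δ_Ω⁻¹` and `T_φ = C_φ ∘ Δ_{Ω'}⁻¹ ∘ C_{φ⁻¹}`, the composition operators are
well-defined bounded operators between the `L^p` spaces and
`‖T - T_φ‖_{L^p(Ω) → L^p(Ω)} ≤ C * ‖1 - |det Dφ|‖_{L^∞(Ω)} / inf_Ω |det Dφ|`. -/
def InverseLaplacianBound (p : ℝ≥0∞) [Fact (1 ≤ p)] (Ω : Set Plane)
    (φ : OpenPartialHomeomorph Plane Plane) (Ω' : Set Plane) (C : ℝ≥0) : Prop :=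
  ∃ (Cφ : LpSpace p Ω' →L[ℝ] LpSpace p Ω) (Cφinv : LpSpace p Ω →L[ℝ] LpSpace p Ω'),
    IsCompositionOperator φ Cφ ∧ IsCompositionOperator φ.symm Cφinv ∧
    ‖inverseLaplacian p Ω - Cφ ∘L inverseLaplacian p Ω' ∘L Cφinv‖ₑ ≤
      C * (eLpNorm (fun x => 1 - absJac φ x) ∞ (volume.restrict Ω) /
        ⨅ x ∈ Ω, ENNReal.ofReal (absJac φ x))

end PlaneDomain

end

/-!
The estimate rests on the conformal invariance of the Dirichlet Laplacian. Write `J = |det Dφ|`.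
If `w ∈ X_p(Ω')` then `w ∘ φ ∈ X_p(Ω)` and `Δ (w ∘ φ) = J · (Δ w) ∘ φ`
(`CauchyRiemannOn.exists_comp_mem_Xp`). Applied to `w = Δ_{Ω'}⁻¹ (f ∘ φ⁻¹)` this gives
`T_φ f = T (J f)` (`CauchyRiemannOn.comp_inverseLaplacian_comp`), and the two estimates follow.

* `(T - T_φ) f = T ((1 - J) f)`, so `‖T - T_φ‖ ≤ ‖T‖ ‖1 - J‖_∞`. If `inf J ≤ M`, this is at most
  `M ‖T‖ ‖1 - J‖_∞ / inf J`.
* `(T - T_φ) f = T_φ (f / J - f) = C_φ (T' (C_{φ⁻¹} (f / J - f)))` with `T' = Δ_{Ω'}⁻¹`. Here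
  `‖C_φ‖ ≤ (inf J)^{-1/p}` and
  `‖C_{φ⁻¹} (f / J - f)‖ ≤ (inf J)^{1/p - 1} ‖1 - J‖_∞ ‖f‖`. The second bound
  (`CauchyRiemannOn.enorm_comp_symm_sub_le`) keeps the Jacobian of the change of variables together
  with the multiplier, so that `sup J` does not enter, and the powers of `inf J` multiply to
  `(inf J)⁻¹`.

For the invariance, `φ` has to be smooth. Its second weak derivatives are bounded, so mixed second
differences of its mollifications are uniformly bounded, hence so are those of `φ`, and the
derivative of `φ`, which exists everywhere, is continuous (`continuousOn_partialDeriv`). The sign of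
`det Dφ` is therefore constant on the connected set `Ω`, and `φ` is holomorphic or antiholomorphic
(`exists_cauchyRiemannOn`). The chain rule for weak derivatives (`IsWeakPartial.comp`) comes from
moving the transformation onto the test function.
-/

noncomputable section

namespace PlaneDomain

open Filter Topology ContinuousLinearMap

/-! ### Mollification and the regularity of functions with bounded second weak derivatives -/

/-- Mollification of the restriction of `u` to `K`, extended by zero. -/
def mollify (ρ : ContDiffBump (0 : Plane)) (K : Set Plane) (u : Plane → ℝ) : Plane → ℝ :=
  convolution (ρ.normed volume) (K.indicator u) (lsmul ℝ ℝ) volume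

theorem setIntegral_mul_eq_integral_mul_indicator {Ω K : Set Plane} {ζ u : Plane → ℝ}
    (hΩ : MeasurableSet Ω) (hK : MeasurableSet K) (hKΩ : K ⊆ Ω) (hζ : ∀ y, ζ y ≠ 0 → y ∈ K) :
    ∫ y in Ω, ζ y * u y = ∫ y, ζ y * K.indicator u y := by
  rw [setIntegral_eq_of_subset_of_forall_sdiff_eq_zero hΩ hKΩ (fun y hy => ?_),
    ← integral_indicator hK]
  · refine integral_congr_ae (.of_forall fun y => ?_)
    by_cases hy : y ∈ K <;> simp [hy]
  · have : ζ y = 0 := by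
      by_contra h0
      exact hy.2 (hζ y h0)
    simp [this]

theorem mollify_eq (ρ : ContDiffBump (0 : Plane)) (K : Set Plane) (u : Plane → ℝ) (x : Plane) :
    mollify ρ K u x = ∫ y, ρ.normed volume (x - y) * K.indicator u y := by
  rw [mollify, convolution_eq_swap]
  simp

theorem contDiff_mollify (ρ : ContDiffBump (0 : Plane)) {K : Set Plane} {u : Plane → ℝ}
    (hK : MeasurableSet K) (hu : IntegrableOn u K) : ContDiff ℝ ∞ (mollify ρ K u) :=
  ρ.hasCompactSupport_normed.contDiff_convolution_left _ ρ.contDiff_normed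
    (hu.integrable_indicator hK).locallyIntegrable

theorem partialDeriv_convolution (i : Fin 2) {η u : Plane → ℝ} (hη : ContDiff ℝ ∞ η)
    (hc : HasCompactSupport η) (hu : LocallyIntegrable u volume) (x : Plane) :
    partialDeriv i (convolution η u (lsmul ℝ ℝ) volume) x
      = ∫ t, partialDeriv i η t * u (x - t) := by
  have hd := hc.hasFDerivAt_convolution_left (μ := volume)
    (lsmul ℝ ℝ) ((hη.of_le (by exact_mod_cast le_top)) : ContDiff ℝ 1 η) hu x
  have hex := (hc.fderiv (𝕜 := ℝ)).convolutionExists_left (μ := volume)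
      (precompL Plane (lsmul ℝ ℝ)) (hη.continuous_fderiv (by simp)) hu x
  rw [partialDeriv, hd.fderiv]
  unfold convolution
  rw [ContinuousLinearMap.integral_apply hex.integrable]
  refine integral_congr_ae (.of_forall fun t => ?_)
  simp [precompL_apply, partialDeriv]

/-- Weak derivatives of `u` become classical derivatives of its mollification, at points whose
distance from the complement of `K` exceeds the mollification radius. -/
theorem IsWeakPartial.partialDeriv_mollify {Ω K : Set Plane} {i : Fin 2} {u g : Plane → ℝ}
    (h : IsWeakPartial Ω i u g) (hΩ : IsOpen Ω) (hK : IsCompact K) (hKΩ : K ⊆ Ω)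
    (ρ : ContDiffBump (0 : Plane)) {x : Plane} (hx : Metric.closedBall x ρ.rOut ⊆ K) :
    partialDeriv i (mollify ρ K u) x = mollify ρ K g x := by
  set η : Plane → ℝ := ρ.normed volume
  set ψ : Plane → ℝ := fun y => η (x - y)
  have hηs : ContDiff ℝ ∞ η := ρ.contDiff_normed
  have hηd : Differentiable ℝ η := hηs.differentiable (by simp)
  have hul : LocallyIntegrable (K.indicator u) volume :=
    ((h.locInt.integrableOn_compact_subset hKΩ hK).integrable_indicator
      hK.measurableSet).locallyIntegrable
  have hsupp : Function.support ψ ⊆ Metric.closedBall x ρ.rOut := by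
    intro y hy
    have h1 : x - y ∈ Metric.closedBall (0 : Plane) ρ.rOut := by
      rw [← ρ.tsupport_normed_eq (μ := volume)]
      exact subset_tsupport _ hy
    rw [mem_closedBall_zero_iff] at h1
    rw [Metric.mem_closedBall, dist_comm, dist_eq_norm]
    exact h1
  have htsupp : tsupport ψ ⊆ Metric.closedBall x ρ.rOut :=
    closure_minimal hsupp Metric.isClosed_closedBall
  have htest : IsTestFunction Ω ψ := by
    refine ⟨hηs.comp (contDiff_const.sub contDiff_id), ?_, (htsupp.trans hx).trans hKΩ⟩
    exact HasCompactSupport.of_support_subset_isCompact (isCompact_closedBall x ρ.rOut) hsupp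
  have hpd : ∀ y, partialDeriv i ψ y = - fderiv ℝ η (x - y) (EuclideanSpace.single i 1) := by
    intro y
    have h1 : HasFDerivAt ψ
        ((fderiv ℝ η (x - y)).comp (-ContinuousLinearMap.id ℝ Plane)) y := by
      refine (hηd (x - y)).hasFDerivAt.comp y ?_
      simpa using (hasFDerivAt_id (𝕜 := ℝ) y).const_sub x
    rw [partialDeriv, h1.fderiv]
    simp
  have e1 : partialDeriv i (mollify ρ K u) x
      = ∫ t, fderiv ℝ η t (EuclideanSpace.single i 1) * K.indicator u (x - t) :=
    partialDeriv_convolution i hηs ρ.hasCompactSupport_normed hul x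
  have e2 : ∫ t, fderiv ℝ η t (EuclideanSpace.single i 1) * K.indicator u (x - t)
      = ∫ y, - (partialDeriv i ψ y * K.indicator u y) := by
    rw [← integral_sub_left_eq_self _ volume x]
    refine integral_congr_ae (.of_forall fun t => ?_)
    simp [hpd]
  rw [e1, e2, integral_neg,
    ← setIntegral_mul_eq_integral_mul_indicator hΩ.measurableSet hK.measurableSet hKΩ,
    h.integral_eq ψ htest, neg_neg, mollify_eq,
    setIntegral_mul_eq_integral_mul_indicator hΩ.measurableSet hK.measurableSet hKΩ]
  · exact fun y hy => hx (hsupp hy)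
  · exact fun y hy => hx (htsupp (tsupport_fderiv_apply_subset ℝ _ (subset_tsupport _ hy)))

theorem norm_mollify_le {Ω K : Set Plane} (hKΩ : K ⊆ Ω) (hK : MeasurableSet K)
    {h : Plane → ℝ} {L : ℝ} (hL : 0 ≤ L) (hh : ∀ᵐ x ∂(volume.restrict Ω), ‖h x‖ ≤ L)
    (ρ : ContDiffBump (0 : Plane)) (x : Plane) : ‖mollify ρ K h x‖ ≤ L := by
  have hb : ∀ᵐ y, ‖K.indicator h y‖ ≤ L := by
    have h1 : ∀ᵐ y ∂(volume.restrict K), ‖h y‖ ≤ L := ae_restrict_of_ae_restrict_of_subset hKΩ hh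
    rw [ae_restrict_iff' hK] at h1
    filter_upwards [h1] with y hy
    by_cases hyK : y ∈ K
    · simpa [hyK] using hy hyK
    · simpa [hyK] using hL
  have hi : Integrable (fun y => ρ.normed volume (x - y) * L) :=
    (ρ.integrable_normed.comp_sub_left x).mul_const L
  rw [mollify_eq]
  refine (norm_integral_le_of_norm_le hi ?_).trans_eq ?_
  · filter_upwards [hb] with y hy
    rw [norm_mul, Real.norm_of_nonneg (ρ.nonneg_normed _)]
    exact mul_le_mul_of_nonneg_left hy (ρ.nonneg_normed _)
  · rw [integral_mul_const, integral_sub_left_eq_self (ρ.normed volume) volume x,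
      ρ.integral_normed, one_mul]

theorem plane_eq_sum (v : Plane) : v = ∑ i, v i • EuclideanSpace.single i (1 : ℝ) := by
  ext j
  fin_cases j <;> simp

theorem norm_clm_plane_le {A : Plane →L[ℝ] ℝ} {L : ℝ} (hL : 0 ≤ L)
    (hA : ∀ i, ‖A (EuclideanSpace.single i 1)‖ ≤ L) : ‖A‖ ≤ 2 * L := by
  refine A.opNorm_le_bound (by positivity) fun v => ?_
  have h1 : A v = ∑ i, v i * A (EuclideanSpace.single i 1) := by
    conv_lhs => rw [plane_eq_sum v]
    simp
  rw [h1]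
  refine (norm_sum_le _ _).trans ?_
  have h2 : ∀ i, ‖v i * A (EuclideanSpace.single i 1)‖ ≤ ‖v‖ * L := fun i => by
    rw [norm_mul]
    exact mul_le_mul (PiLp.norm_apply_le v i) (hA i) (norm_nonneg _) (norm_nonneg _)
  refine (Finset.sum_le_sum fun i _ => h2 i).trans_eq ?_
  simp
  ring

theorem hasDerivAt_line {u : Plane → ℝ} {x : Plane} (i : Fin 2) (t : ℝ)
    (hu : DifferentiableAt ℝ u (x + t • EuclideanSpace.single i 1)) :
    HasDerivAt (fun s : ℝ => u (x + s • EuclideanSpace.single i 1))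
      (partialDeriv i u (x + t • EuclideanSpace.single i 1)) t := by
  have h1 : HasDerivAt (fun s : ℝ => x + s • (EuclideanSpace.single i 1 : Plane))
      (EuclideanSpace.single i 1) t := by
    simpa using ((hasDerivAt_id t).smul_const (EuclideanSpace.single i 1 : Plane)).const_add x
  exact hu.hasFDerivAt.comp_hasDerivAt t h1

/-- The mixed difference `F (x + t eᵢ) - F (y + t eᵢ) - (F x - F y)` of a smooth function is
controlled by its second derivatives. -/
theorem abs_mixed_difference_le {F : Plane → ℝ} (hF : ContDiff ℝ ∞ F) {x₀ : Plane} {r L : ℝ}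
    (hL : 0 ≤ L) {i : Fin 2}
    (hb : ∀ z ∈ Metric.ball x₀ (2 * r), ∀ j, ‖partialDeriv j (partialDeriv i F) z‖ ≤ L)
    {x y : Plane} (hx : x ∈ Metric.ball x₀ r) (hy : y ∈ Metric.ball x₀ r) {t : ℝ} (ht : |t| < r) :
    |(F (x + t • EuclideanSpace.single i 1) - F (y + t • EuclideanSpace.single i 1))
      - (F x - F y)| ≤ 2 * L * ‖x - y‖ * |t| := by
  have hd1 : Differentiable ℝ F := hF.differentiable (by simp)
  have hd2 : Differentiable ℝ (partialDeriv i F) := by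
    have : ContDiff ℝ ∞ (partialDeriv i F) :=
      (hF.fderiv_right (m := ∞) (by simp)).clm_apply contDiff_const
    exact this.differentiable (by simp)
  have hmem : ∀ z ∈ Metric.ball x₀ r, ∀ s ∈ Metric.ball (0 : ℝ) r,
      z + s • EuclideanSpace.single i (1 : ℝ) ∈ Metric.ball x₀ (2 * r) := by
    intro z hz s hs
    rw [Metric.mem_ball] at hz ⊢
    rw [mem_ball_zero_iff] at hs
    calc dist (z + s • EuclideanSpace.single i (1 : ℝ)) x₀
        ≤ dist (z + s • EuclideanSpace.single i (1 : ℝ)) z + dist z x₀ := dist_triangle _ _ _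
      _ < r + r := by
        refine add_lt_add ?_ hz
        simpa [norm_smul] using hs
      _ = 2 * r := by ring
  have hr : 0 < r := (abs_nonneg t).trans_lt ht
  have key := Convex.norm_image_sub_le_of_norm_hasDerivWithin_le (s := Metric.ball (0 : ℝ) r)
    (f := fun s : ℝ => F (x + s • EuclideanSpace.single i 1)
      - F (y + s • EuclideanSpace.single i 1))
    (f' := fun s : ℝ => partialDeriv i F (x + s • EuclideanSpace.single i 1)
      - partialDeriv i F (y + s • EuclideanSpace.single i 1))
    (C := 2 * L * ‖x - y‖) (x := 0) (y := t)
    (fun s _ => ((hasDerivAt_line i s (hd1 _)).sub (hasDerivAt_line i s (hd1 _))).hasDerivWithinAt)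
    (fun s hs => ?_) (convex_ball _ _) (Metric.mem_ball_self hr) (by simpa using ht)
  · simpa using key
  · have := Convex.norm_image_sub_le_of_norm_fderiv_le (𝕜 := ℝ) (f := partialDeriv i F)
      (C := 2 * L) (s := Metric.ball x₀ (2 * r)) (fun z _ => hd2 z)
      (fun z hz => norm_clm_plane_le hL (hb z hz)) (convex_ball _ _)
      (hmem y hy s hs) (hmem x hx s hs)
    simpa using this

/-- A differentiable function whose second weak derivatives are bounded is continuously
differentiable: mollifications satisfy a uniform bound on mixed second differences, which passes
to the limit. -/
theorem continuousOn_partialDeriv {Ω : Set Plane} (hΩ : IsOpen Ω) {u : Plane → ℝ}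
    (hu : ∀ x ∈ Ω, DifferentiableAt ℝ u x) {g : Fin 2 → Plane → ℝ} {h : Fin 2 → Fin 2 → Plane → ℝ}
    (hg : ∀ i, IsWeakPartial Ω i u (g i)) (hh : ∀ i j, IsWeakPartial Ω j (g i) (h i j))
    {L : ℝ} (hL : 0 ≤ L) (hb : ∀ i j, ∀ᵐ x ∂(volume.restrict Ω), ‖h i j x‖ ≤ L) (i : Fin 2) :
    ContinuousOn (partialDeriv i u) Ω := by
  intro x₀ hx₀
  refine ContinuousAt.continuousWithinAt ?_
  obtain ⟨R, hR, hRΩ⟩ := Metric.isOpen_iff.1 hΩ x₀ hx₀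
  obtain ⟨r, hr, hrR⟩ : ∃ r : ℝ, 0 < r ∧ 3 * r < R := ⟨R / 4, by positivity, by linarith⟩
  set K := Metric.closedBall x₀ (3 * r)
  have hK : IsCompact K := isCompact_closedBall _ _
  have hKΩ : K ⊆ Ω := (Metric.closedBall_subset_ball hrR).trans hRΩ
  have hmem : ∀ z ∈ Metric.ball x₀ r, ∀ s : ℝ, |s| < r →
      z + s • EuclideanSpace.single i (1 : ℝ) ∈ Metric.ball x₀ (2 * r) := by
    intro z hz s hs
    rw [Metric.mem_ball] at hz ⊢
    calc dist (z + s • EuclideanSpace.single i (1 : ℝ)) x₀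
        ≤ dist (z + s • EuclideanSpace.single i (1 : ℝ)) z + dist z x₀ := dist_triangle _ _ _
      _ < r + r := by
        refine add_lt_add ?_ hz
        simpa [norm_smul] using hs
      _ = 2 * r := by ring
  have hball : ∀ ρ : ContDiffBump (0 : Plane), ρ.rOut < r → ∀ z ∈ Metric.ball x₀ (2 * r),
      Metric.closedBall z ρ.rOut ⊆ K := by
    intro ρ hρ z hz
    refine Metric.closedBall_subset_closedBall' ?_
    rw [Metric.mem_ball] at hz
    linarith
  have hconv : ∀ z ∈ Metric.ball x₀ (2 * r), ∀ ε > 0, ∃ δ > 0, ∀ ρ : ContDiffBump (0 : Plane),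
      ρ.rOut < δ → |mollify ρ K u z - u z| ≤ ε := by
    intro z hz ε hε
    have hzK : z ∈ K := Metric.ball_subset_closedBall
      (Metric.ball_subset_ball (by linarith) hz : z ∈ Metric.ball x₀ (3 * r))
    have hcz : Tendsto u (𝓝 z) (𝓝 (u z)) := (hu z (hKΩ hzK)).continuousAt
    obtain ⟨δ, hδ, hδ'⟩ := Metric.tendsto_nhds_nhds.1 hcz ε hε
    refine ⟨min δ r, lt_min hδ hr, fun ρ hρ => ?_⟩
    have hum : AEStronglyMeasurable (K.indicator u) volume :=
      (((hg i).locInt.integrableOn_compact_subset hKΩ hK).integrable_indicator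
        hK.measurableSet).aestronglyMeasurable
    have := ContDiffBump.dist_normed_convolution_le (φ := ρ) (x₀ := z) (ε := ε) hum ?_
    · rwa [indicator_of_mem hzK, Real.dist_eq] at this
    · intro y hy
      have hyK : y ∈ K := hball ρ (hρ.trans_le (min_le_right _ _)) z hz
        (Metric.ball_subset_closedBall hy)
      rw [indicator_of_mem hyK, indicator_of_mem hzK]
      exact (hδ' (lt_trans hy (hρ.trans_le (min_le_left _ _)))).le
  -- mollify at a radius so small that all four values of `u` change by at most `ε / 4`
  have hmixed : ∀ x ∈ Metric.ball x₀ r, ∀ y ∈ Metric.ball x₀ r, ∀ t : ℝ, |t| < r →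
      |(u (x + t • EuclideanSpace.single i 1) - u (y + t • EuclideanSpace.single i 1))
      - (u x - u y)| ≤ 2 * L * ‖x - y‖ * |t| := by
    intro x hx y hy t ht
    refine le_of_forall_pos_le_add fun ε hε => ?_
    have hsub : Metric.ball x₀ r ⊆ Metric.ball x₀ (2 * r) :=
      Metric.ball_subset_ball (by linarith)
    obtain ⟨δ₁, h₁, h₁'⟩ := hconv _ (hmem x hx t ht) (ε / 4) (by positivity)
    obtain ⟨δ₂, h₂, h₂'⟩ := hconv _ (hmem y hy t ht) (ε / 4) (by positivity)
    obtain ⟨δ₃, h₃, h₃'⟩ := hconv x (hsub hx) (ε / 4) (by positivity)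
    obtain ⟨δ₄, h₄, h₄'⟩ := hconv y (hsub hy) (ε / 4) (by positivity)
    obtain ⟨δ, hδ, hδ'⟩ : ∃ δ : ℝ, 0 < δ ∧ (δ < δ₁ ∧ δ < δ₂ ∧ δ < δ₃ ∧ δ < δ₄ ∧ δ < r) := by
      have : 0 < min δ₁ (min δ₂ (min δ₃ (min δ₄ r))) := by
        simp only [lt_min_iff]; exact ⟨h₁, h₂, h₃, h₄, hr⟩
      obtain ⟨δ, hδ, hδ'⟩ := exists_between this
      simp only [lt_min_iff] at hδ'
      exact ⟨δ, hδ, hδ'⟩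
    let ρ : ContDiffBump (0 : Plane) := ⟨δ / 2, δ, by positivity, by linarith⟩
    have hρr : ρ.rOut < r := hδ'.2.2.2.2
    have a1 := abs_le.1 (h₁' ρ hδ'.1)
    have a2 := abs_le.1 (h₂' ρ hδ'.2.1)
    have a3 := abs_le.1 (h₃' ρ hδ'.2.2.1)
    have a4 := abs_le.1 (h₄' ρ hδ'.2.2.2.1)
    have hp : ∀ z ∈ Metric.ball x₀ (2 * r), ∀ j,
        ‖partialDeriv j (partialDeriv i (mollify ρ K u)) z‖ ≤ L := by
      intro z hz j
      have h1 : partialDeriv i (mollify ρ K u) =ᶠ[𝓝 z] mollify ρ K (g i) := by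
        filter_upwards [Metric.isOpen_ball.mem_nhds hz] with w hw
        exact (hg i).partialDeriv_mollify hΩ hK hKΩ ρ (hball ρ hρr w hw)
      have h2 : partialDeriv j (partialDeriv i (mollify ρ K u)) z = mollify ρ K (h i j) z := by
        rw [partialDeriv, h1.fderiv_eq]
        exact (hh i j).partialDeriv_mollify hΩ hK hKΩ ρ (hball ρ hρr z hz)
      rw [h2]
      exact norm_mollify_le hKΩ hK.measurableSet hL (hb i j) ρ z
    have key := abs_le.1 (abs_mixed_difference_le
      (contDiff_mollify ρ hK.measurableSet ((hg i).locInt.integrableOn_compact_subset hKΩ hK))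
      hL hp hx hy ht)
    rw [abs_le]
    constructor <;> linarith [key.1, key.2, a1.1, a1.2, a2.1, a2.2, a3.1, a3.2, a4.1, a4.2]
  have hlip : ∀ x ∈ Metric.ball x₀ r, ‖partialDeriv i u x - partialDeriv i u x₀‖
      ≤ 2 * L * ‖x - x₀‖ := by
    intro x hx
    have hxΩ : x ∈ Ω := hKΩ (Metric.ball_subset_closedBall
      (Metric.ball_subset_ball (by linarith) hx : x ∈ Metric.ball x₀ (3 * r)))
    have d1 := hasDerivAt_line (u := u) (x := x) i 0 (by simpa using hu x hxΩ)
    have d2 := hasDerivAt_line (u := u) (x := x₀) i 0 (by simpa using hu x₀ hx₀)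
    have d := d1.sub d2
    rw [zero_smul, add_zero, add_zero] at d
    refine d.le_of_lip' (by positivity) ?_
    filter_upwards [Metric.ball_mem_nhds (0 : ℝ) hr] with t ht
    rw [mem_ball_zero_iff, Real.norm_eq_abs] at ht
    simpa using hmixed x hx x₀ (Metric.mem_ball_self hr) t ht
  refine tendsto_iff_norm_sub_tendsto_zero.2 ?_
  refine squeeze_zero' (.of_forall fun _ => norm_nonneg _)
    (eventually_of_mem (Metric.ball_mem_nhds x₀ hr) hlip) ?_
  have : Continuous fun x : Plane => 2 * L * ‖x - x₀‖ := by fun_prop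
  simpa using this.tendsto x₀

/-! ### Conformal maps of the plane and the Cauchy–Riemann equations -/

/-- `∂ᵢ fₖ`. -/
def jacEntry (f : Plane → Plane) (k i : Fin 2) : Plane → ℝ := partialDeriv i fun x => f x k

theorem jacEntry_eq {f : Plane → Plane} {x : Plane} (hf : DifferentiableAt ℝ f x) (k i : Fin 2) :
    jacEntry f k i x = fderiv ℝ f x (EuclideanSpace.single i 1) k := by
  have h1 : HasFDerivAt (fun x => f x k)
      ((EuclideanSpace.proj k : Plane →L[ℝ] ℝ).comp (fderiv ℝ f x)) x :=
    (EuclideanSpace.proj k : Plane →L[ℝ] ℝ).hasFDerivAt.comp x hf.hasFDerivAt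
  rw [jacEntry, partialDeriv, h1.fderiv]
  simp

theorem clm_plane_det (A : Plane →L[ℝ] Plane) :
    A.det = A (EuclideanSpace.single 0 1) 0 * A (EuclideanSpace.single 1 1) 1
      - A (EuclideanSpace.single 1 1) 0 * A (EuclideanSpace.single 0 1) 1 := by
  have h := LinearMap.det_toMatrix (EuclideanSpace.basisFun (Fin 2) ℝ).toBasis
    (A : Plane →ₗ[ℝ] Plane)
  rw [Matrix.det_fin_two] at h
  rw [ContinuousLinearMap.det, ← h]
  simp [LinearMap.toMatrix_apply]

theorem fderiv_plane_apply (u : Plane → ℝ) (x v : Plane) :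
    fderiv ℝ u x v = ∑ i, v i * partialDeriv i u x := by
  conv_lhs => rw [plane_eq_sum v]
  simp [partialDeriv]

/-- `f` is smooth on `U` with nowhere vanishing derivative, and satisfies the Cauchy–Riemann
equations (`s = 1`, `f` holomorphic) or the conjugate ones (`s = -1`, `f` antiholomorphic). -/
structure CauchyRiemannOn (s : ℝ) (f : Plane → Plane) (U : Set Plane) : Prop where
  sign : s * s = 1
  smooth : ContDiffOn ℝ ∞ f U
  eq_diag : ∀ x ∈ U, jacEntry f 1 1 x = s * jacEntry f 0 0 x
  eq_off : ∀ x ∈ U, jacEntry f 1 0 x = - s * jacEntry f 0 1 x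
  absJac_pos : ∀ x ∈ U, 0 < absJac f x

section CauchyRiemann

variable {s : ℝ} {f : Plane → Plane} {U : Set Plane}

theorem absJac_eq_abs {x : Plane} (hf : DifferentiableAt ℝ f x) :
    absJac f x = |jacEntry f 0 0 x * jacEntry f 1 1 x - jacEntry f 0 1 x * jacEntry f 1 0 x| := by
  rw [absJac, clm_plane_det]
  simp only [jacEntry_eq hf]

theorem CauchyRiemannOn.differentiableAt (h : CauchyRiemannOn s f U) (hU : IsOpen U) {x : Plane}
    (hx : x ∈ U) : DifferentiableAt ℝ f x :=
  (h.smooth.contDiffAt (hU.mem_nhds hx)).differentiableAt (by simp)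

theorem CauchyRiemannOn.absJac_eq (h : CauchyRiemannOn s f U) (hU : IsOpen U) {x : Plane}
    (hx : x ∈ U) : absJac f x = jacEntry f 0 0 x ^ 2 + jacEntry f 0 1 x ^ 2 := by
  rw [absJac_eq_abs (h.differentiableAt hU hx), h.eq_diag x hx, h.eq_off x hx]
  have hs : |s| = 1 := by
    have := h.sign
    rw [← abs_mul_abs_self] at this
    nlinarith [abs_nonneg s]
  rw [show jacEntry f 0 0 x * (s * jacEntry f 0 0 x) - jacEntry f 0 1 x * (-s * jacEntry f 0 1 x)
    = s * (jacEntry f 0 0 x ^ 2 + jacEntry f 0 1 x ^ 2) by ring, abs_mul, hs, one_mul,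
    abs_of_nonneg (by positivity)]

theorem CauchyRiemannOn.sum_row_mul_row (h : CauchyRiemannOn s f U) (hU : IsOpen U) {x : Plane}
    (hx : x ∈ U) (i j : Fin 2) :
    ∑ k, jacEntry f i k x * jacEntry f j k x = if i = j then absJac f x else 0 := by
  have hs := h.sign
  rw [h.absJac_eq hU hx]
  fin_cases i <;> fin_cases j <;> simp [h.eq_diag x hx, h.eq_off x hx]
  · ring
  · ring
  · ring
  · linear_combination (jacEntry f 0 0 x ^ 2 + jacEntry f 0 1 x ^ 2) * hs

theorem contDiffOn_partialDeriv {u : Plane → ℝ} (hU : IsOpen U) (hu : ContDiffOn ℝ ∞ u U)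
    (i : Fin 2) : ContDiffOn ℝ ∞ (partialDeriv i u) U :=
  (hu.fderiv_of_isOpen (m := ∞) hU (by simp)).clm_apply contDiffOn_const

theorem CauchyRiemannOn.contDiffOn_coord (h : CauchyRiemannOn s f U) (k : Fin 2) :
    ContDiffOn ℝ ∞ (fun x => f x k) U :=
  (EuclideanSpace.proj k : Plane →L[ℝ] ℝ).contDiff.comp_contDiffOn h.smooth

theorem CauchyRiemannOn.contDiffOn_jacEntry (h : CauchyRiemannOn s f U) (hU : IsOpen U)
    (k i : Fin 2) : ContDiffOn ℝ ∞ (jacEntry f k i) U :=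
  contDiffOn_partialDeriv hU (h.contDiffOn_coord k) i

theorem CauchyRiemannOn.continuousOn_absJac (h : CauchyRiemannOn s f U) (hU : IsOpen U) :
    ContinuousOn (absJac f) U := by
  refine ContinuousOn.congr ?_ fun x hx => h.absJac_eq hU hx
  exact ((h.contDiffOn_jacEntry hU 0 0).continuousOn.pow 2).add
    ((h.contDiffOn_jacEntry hU 0 1).continuousOn.pow 2)

theorem partialDeriv_comm {u : Plane → ℝ} (hU : IsOpen U) (hu : ContDiffOn ℝ ∞ u U) {x : Plane}
    (hx : x ∈ U) (i j : Fin 2) :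
    partialDeriv i (partialDeriv j u) x = partialDeriv j (partialDeriv i u) x := by
  have hux := hu.contDiffAt (hU.mem_nhds hx)
  have hd : DifferentiableAt ℝ (fderiv ℝ u) x :=
    (hux.fderiv_right (m := ∞) (by simp)).differentiableAt (by simp)
  have h2 : ∀ a b : Fin 2, partialDeriv a (partialDeriv b u) x
      = fderiv ℝ (fderiv ℝ u) x (EuclideanSpace.single a 1) (EuclideanSpace.single b 1) := by
    intro a b
    change fderiv ℝ (fun y => fderiv ℝ u y (EuclideanSpace.single b 1)) x _ = _
    rw [fderiv_clm_apply hd (differentiableAt_const _)]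
    simp
  rw [h2, h2]
  exact (hux.isSymmSndFDerivAt (by simpa using WithTop.coe_le_coe.2 (le_top : (2 : ℕ∞) ≤ ⊤))).eq _ _

theorem partialDeriv_congr {u v : Plane → ℝ} (hU : IsOpen U) (h : ∀ x ∈ U, u x = v x) {x : Plane}
    (hx : x ∈ U) (i : Fin 2) : partialDeriv i u x = partialDeriv i v x := by
  have : u =ᶠ[𝓝 x] v := eventually_of_mem (hU.mem_nhds hx) h
  rw [partialDeriv, partialDeriv, this.fderiv_eq]

theorem partialDeriv_const_mul' {u : Plane → ℝ} {x : Plane} (hu : DifferentiableAt ℝ u x) (c : ℝ)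
    (i : Fin 2) : partialDeriv i (fun y => c * u y) x = c * partialDeriv i u x := by
  rw [partialDeriv, fderiv_const_mul hu]
  rfl

/-- The coordinates of a holomorphic or antiholomorphic map are harmonic. -/
theorem CauchyRiemannOn.harmonic (h : CauchyRiemannOn s f U) (hU : IsOpen U) {x : Plane}
    (hx : x ∈ U) (k : Fin 2) : ∑ i, partialDeriv i (jacEntry f k i) x = 0 := by
  have hs := h.sign
  have hd : ∀ k i, DifferentiableAt ℝ (jacEntry f k i) x := fun k i =>
    ((h.contDiffOn_jacEntry hU k i).contDiffAt (hU.mem_nhds hx)).differentiableAt (by simp)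
  have c0 := partialDeriv_comm hU (h.contDiffOn_coord 0) hx 0 1
  have c1 := partialDeriv_comm hU (h.contDiffOn_coord 1) hx 0 1
  have e1 : ∀ i, partialDeriv i (jacEntry f 1 1) x = s * partialDeriv i (jacEntry f 0 0) x :=
    fun i => by rw [partialDeriv_congr hU h.eq_diag hx, partialDeriv_const_mul' (hd 0 0)]
  have e2 : ∀ i, partialDeriv i (jacEntry f 1 0) x = -s * partialDeriv i (jacEntry f 0 1) x :=
    fun i => by rw [partialDeriv_congr hU h.eq_off hx, partialDeriv_const_mul' (hd 0 1)]
  change partialDeriv 0 (jacEntry f 0 1) x = partialDeriv 1 (jacEntry f 0 0) x at c0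
  change partialDeriv 0 (jacEntry f 1 1) x = partialDeriv 1 (jacEntry f 1 0) x at c1
  rw [Fin.sum_univ_two]
  fin_cases k
  · change partialDeriv 0 (jacEntry f 0 0) x + partialDeriv 1 (jacEntry f 0 1) x = 0
    have e0 := e1 0
    have e3 := e2 1
    linear_combination (-(partialDeriv 0 (jacEntry f 0 0) x
      + partialDeriv 1 (jacEntry f 0 1) x)) * hs - s * e0 + s * c1 + s * e3
  · change partialDeriv 0 (jacEntry f 1 0) x + partialDeriv 1 (jacEntry f 1 1) x = 0
    rw [e1, e2]
    linear_combination (-s) * c0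

/-- The Cauchy–Riemann equations at a point from conformality there, with the sign of the
Jacobian determinant. -/
theorem exists_sign_of_conformalAt {x : Plane} (hc : ConformalAt f x) :
    ∃ c s : ℝ, 0 < c ∧ (s = 1 ∨ s = -1) ∧
      jacEntry f 0 0 x * jacEntry f 1 1 x - jacEntry f 0 1 x * jacEntry f 1 0 x = s * c ∧
      jacEntry f 1 1 x = s * jacEntry f 0 0 x ∧ jacEntry f 1 0 x = - s * jacEntry f 0 1 x := by
  have hd := hc.differentiableAt
  obtain ⟨c, hc0, hin⟩ := conformalAt_iff'.1 hc
  have h00 := hin (EuclideanSpace.single 0 1) (EuclideanSpace.single 0 1)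
  have h11 := hin (EuclideanSpace.single 1 1) (EuclideanSpace.single 1 1)
  have h01 := hin (EuclideanSpace.single 0 1) (EuclideanSpace.single 1 1)
  simp only [PiLp.inner_apply, Fin.sum_univ_two, ← jacEntry_eq hd] at h00 h11 h01
  simp at h00 h11 h01
  set a := jacEntry f 0 0 x
  set b := jacEntry f 0 1 x
  set c' := jacEntry f 1 0 x
  set d := jacEntry f 1 1 x
  -- the columns of the derivative are orthogonal of square length `c`, so `det ^ 2 = c ^ 2`
  have hdet : (a * d - b * c' - c) * (a * d - b * c' + c) = 0 := by
    linear_combination (b * b + d * d) * h00 + c * h11 - (a * b + c' * d) * h01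
  rcases mul_eq_zero.1 hdet with h | h
  · refine ⟨c, 1, hc0, .inl rfl, by linarith, ?_, ?_⟩
    · have : (a - d) ^ 2 + (b + c') ^ 2 = 0 := by linear_combination h00 + h11 - 2 * h
      nlinarith [sq_nonneg (a - d), sq_nonneg (b + c')]
    · have : (a - d) ^ 2 + (b + c') ^ 2 = 0 := by linear_combination h00 + h11 - 2 * h
      nlinarith [sq_nonneg (a - d), sq_nonneg (b + c')]
  · refine ⟨c, -1, hc0, .inr rfl, by linarith, ?_, ?_⟩
    · have : (a + d) ^ 2 + (b - c') ^ 2 = 0 := by linear_combination h00 + h11 + 2 * h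
      nlinarith [sq_nonneg (a + d), sq_nonneg (b - c')]
    · have : (a + d) ^ 2 + (b - c') ^ 2 = 0 := by linear_combination h00 + h11 + 2 * h
      nlinarith [sq_nonneg (a + d), sq_nonneg (b - c')]

/-- The Cauchy–Riemann equations for `(f₀, s f₁)` make `f₀ + s f₁ i` holomorphic, hence smooth. -/
theorem contDiffOn_of_cauchyRiemann (hU : IsOpen U) (hs : s * s = 1)
    (hf : ∀ x ∈ U, DifferentiableAt ℝ f x)
    (h1 : ∀ x ∈ U, jacEntry f 1 1 x = s * jacEntry f 0 0 x)
    (h2 : ∀ x ∈ U, jacEntry f 1 0 x = - s * jacEntry f 0 1 x) : ContDiffOn ℝ ∞ f U := by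
  let e : ℂ ≃ₗᵢ[ℝ] Plane := Complex.orthonormalBasisOneI.repr
  have e1 : e 1 = EuclideanSpace.single 0 1 := by
    ext j; fin_cases j <;> simp [e]
  have eI : e Complex.I = EuclideanSpace.single 1 1 := by
    ext j; fin_cases j <;> simp [e]
  set F : ℂ → ℂ := fun z => (f (e z) 0 : ℂ) + ((s * f (e z) 1 : ℝ) : ℂ) * Complex.I with hF
  set V : Set ℂ := e ⁻¹' U
  have hV : IsOpen V := hU.preimage e.continuous
  have hFd : DifferentiableOn ℂ F V := by
    intro z hz
    refine DifferentiableAt.differentiableWithinAt ?_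
    have hd := hf (e z) hz
    have hcomp : HasFDerivAt (fun z => f (e z))
        ((fderiv ℝ f (e z)).comp (e.toContinuousLinearEquiv : ℂ →L[ℝ] Plane)) z :=
      hd.hasFDerivAt.comp z e.toContinuousLinearEquiv.hasFDerivAt
    have hk : ∀ k, HasFDerivAt (fun z => f (e z) k) ((EuclideanSpace.proj k : Plane →L[ℝ] ℝ).comp
        ((fderiv ℝ f (e z)).comp (e.toContinuousLinearEquiv : ℂ →L[ℝ] Plane))) z := fun k =>
      (EuclideanSpace.proj k : Plane →L[ℝ] ℝ).hasFDerivAt.comp z hcomp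
    have hFz := (Complex.ofRealCLM.hasFDerivAt.comp z (hk 0)).add
      ((Complex.ofRealCLM.hasFDerivAt.comp z ((hk 1).const_mul s)).mul_const Complex.I)
    have hFz' : HasFDerivAt F _ z := hFz
    rw [differentiableAt_complex_iff_differentiableAt_real]
    refine ⟨hFz'.differentiableAt, ?_⟩
    rw [hFz'.fderiv]
    have j00 := jacEntry_eq hd 0 0
    have j01 := jacEntry_eq hd 0 1
    have j10 := jacEntry_eq hd 1 0
    have j11 := jacEntry_eq hd 1 1
    have g1 := h1 (e z) hz
    have g2 := h2 (e z) hz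
    simp [e1, eI, ← j00, ← j01, ← j10, ← j11, g1, g2]
    apply Complex.ext
    · simp
      linear_combination (-jacEntry f 0 1 (e z)) * hs
    · simp
      linear_combination (jacEntry f 0 0 (e z)) * hs
  have hFs : ContDiffOn ℝ ∞ F V := (hFd.contDiffOn hV).restrict_scalars ℝ
  have hG : ContDiffOn ℝ ∞ (fun x => F (e.symm x)) U :=
    hFs.comp e.symm.contDiff.contDiffOn fun x hx => by simpa [V] using hx
  rw [contDiffOn_euclidean]
  intro k
  fin_cases k
  · refine (Complex.reCLM.contDiff.comp_contDiffOn hG).congr fun x _ => ?_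
    simp [hF]
  · refine (contDiffOn_const (c := s)).mul (Complex.imCLM.contDiff.comp_contDiffOn hG) |>.congr
      fun x _ => ?_
    simp [hF, ← mul_assoc, hs]

/-- A map that is conformal at every point of a connected open set and has continuous partial
derivatives is holomorphic or antiholomorphic: its Jacobian determinant cannot change sign. -/
theorem exists_cauchyRiemannOn (hU : IsOpen U) (hconn : IsPreconnected U)
    (hc : ∀ x ∈ U, ConformalAt f x) (hcont : ∀ k i, ContinuousOn (jacEntry f k i) U) :
    ∃ s, CauchyRiemannOn s f U := by
  set δ : Plane → ℝ := fun x =>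
    jacEntry f 0 0 x * jacEntry f 1 1 x - jacEntry f 0 1 x * jacEntry f 1 0 x with hδ
  have hδc : ContinuousOn δ U :=
    ((hcont 0 0).mul (hcont 1 1)).sub ((hcont 0 1).mul (hcont 1 0))
  have hne : ∀ x ∈ U, δ x ≠ 0 := by
    intro x hx h0
    obtain ⟨c, s, hc0, hs, hdet, -, -⟩ := exists_sign_of_conformalAt (hc x hx)
    have : s * c = 0 := by rw [← hdet]; exact h0
    rcases hs with rfl | rfl <;> linarith
  have hsign : (∀ x ∈ U, 0 < δ x) ∨ ∀ x ∈ U, δ x < 0 := by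
    by_contra hcon
    push Not at hcon
    obtain ⟨⟨x, hx, hx0⟩, y, hy, hy0⟩ := hcon
    obtain ⟨z, hz, hz0⟩ := hconn.intermediate_value hx hy hδc ⟨hx0, hy0⟩
    exact hne z hz hz0
  have hdiff : ∀ x ∈ U, DifferentiableAt ℝ f x := fun x hx => (hc x hx).differentiableAt
  obtain ⟨s, hs, h⟩ : ∃ s : ℝ, s * s = 1 ∧ ∀ x ∈ U,
      jacEntry f 1 1 x = s * jacEntry f 0 0 x ∧ jacEntry f 1 0 x = - s * jacEntry f 0 1 x := by
    rcases hsign with hpos | hneg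
    · refine ⟨1, by norm_num, fun x hx => ?_⟩
      obtain ⟨c, s, hc0, hs, hdet, h⟩ := exists_sign_of_conformalAt (hc x hx)
      have := hpos x hx
      rcases hs with rfl | rfl
      · exact h
      · simp only [hδ] at this
        linarith
    · refine ⟨-1, by norm_num, fun x hx => ?_⟩
      obtain ⟨c, s, hc0, hs, hdet, h⟩ := exists_sign_of_conformalAt (hc x hx)
      have := hneg x hx
      rcases hs with rfl | rfl
      · simp only [hδ] at this
        linarith
      · exact h
  refine ⟨s, hs, contDiffOn_of_cauchyRiemann hU hs hdiff (fun x hx => (h x hx).1)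
    (fun x hx => (h x hx).2), fun x hx => (h x hx).1, fun x hx => (h x hx).2, fun x hx => ?_⟩
  rw [absJac_eq_abs (hdiff x hx)]
  exact abs_pos.2 (hne x hx)

end CauchyRiemann

/-! ### Smooth plane diffeomorphisms, their inverses and the change of variables -/

section Diffeo

variable {s : ℝ} {φ : OpenPartialHomeomorph Plane Plane}

theorem CauchyRiemannOn.exists_hasFDerivAt_equiv (h : CauchyRiemannOn s φ φ.source) {x : Plane}
    (hx : x ∈ φ.source) : ∃ A : Plane ≃L[ℝ] Plane, HasFDerivAt φ (A : Plane →L[ℝ] Plane) x := by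
  have hdet : (fderiv ℝ φ x).det ≠ 0 := abs_pos.1 (h.absJac_pos x hx)
  refine ⟨(fderiv ℝ φ x).toContinuousLinearEquivOfDetNeZero hdet, ?_⟩
  simpa using (h.differentiableAt φ.open_source hx).hasFDerivAt

theorem CauchyRiemannOn.differentiableAt_symm (h : CauchyRiemannOn s φ φ.source) {x : Plane}
    (hx : x ∈ φ.source) : DifferentiableAt ℝ φ.symm (φ x) := by
  obtain ⟨A, hA⟩ := h.exists_hasFDerivAt_equiv hx
  exact (φ.hasFDerivAt_symm (φ.map_source hx) (by rwa [φ.left_inv hx])).differentiableAt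

theorem CauchyRiemannOn.fderiv_symm_comp (h : CauchyRiemannOn s φ φ.source) {x : Plane}
    (hx : x ∈ φ.source) :
    (fderiv ℝ φ.symm (φ x)).comp (fderiv ℝ φ x) = ContinuousLinearMap.id ℝ Plane := by
  have h1 : HasFDerivAt (φ.symm ∘ φ) ((fderiv ℝ φ.symm (φ x)).comp (fderiv ℝ φ x)) x :=
    (h.differentiableAt_symm hx).hasFDerivAt.comp x
      (h.differentiableAt φ.open_source hx).hasFDerivAt
  have h2 : (φ.symm ∘ φ) =ᶠ[𝓝 x] id :=
    eventually_of_mem (φ.open_source.mem_nhds hx) fun y hy => φ.left_inv hy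
  exact h1.unique ((hasFDerivAt_id x).congr_of_eventuallyEq h2)

theorem CauchyRiemannOn.absJac_symm_mul (h : CauchyRiemannOn s φ φ.source) {x : Plane}
    (hx : x ∈ φ.source) : absJac φ.symm (φ x) * absJac φ x = 1 := by
  have h1 := congrArg (fun A : Plane →L[ℝ] Plane => LinearMap.det (A : Plane →ₗ[ℝ] Plane))
    (h.fderiv_symm_comp hx)
  simp only [ContinuousLinearMap.toLinearMap_comp, LinearMap.det_comp] at h1
  rw [show ((ContinuousLinearMap.id ℝ Plane : Plane →L[ℝ] Plane) : Plane →ₗ[ℝ] Plane)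
    = LinearMap.id from rfl, LinearMap.det_id] at h1
  rw [absJac, absJac, ← abs_mul]
  change |LinearMap.det _ * LinearMap.det _| = 1
  rw [h1, abs_one]

/-- For a conformal map the Jacobian matrix of the inverse is the transposed Jacobian matrix
divided by the Jacobian determinant. -/
theorem CauchyRiemannOn.jacEntry_symm_mul (h : CauchyRiemannOn s φ φ.source) {x : Plane}
    (hx : x ∈ φ.source) (i l : Fin 2) :
    jacEntry φ.symm i l (φ x) * absJac φ x = jacEntry φ l i x := by
  have hd := h.differentiableAt φ.open_source hx
  have hd' := h.differentiableAt_symm hx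
  have E : ∀ i j, ∑ k, jacEntry φ k j x * jacEntry φ.symm i k (φ x) = if i = j then 1 else 0 := by
    intro i j
    have h1 : fderiv ℝ φ.symm (φ x) (fderiv ℝ φ x (EuclideanSpace.single j 1)) i
        = (EuclideanSpace.single j (1 : ℝ) : Plane) i := by
      have := congrArg (fun A : Plane →L[ℝ] Plane => A (EuclideanSpace.single j 1) i)
        (h.fderiv_symm_comp hx)
      simpa using this
    rw [plane_eq_sum (fderiv ℝ φ x (EuclideanSpace.single j 1))] at h1
    simp only [map_sum, map_smul, ← jacEntry_eq hd] at h1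
    simp only [Fin.sum_univ_two, PiLp.add_apply, PiLp.smul_apply, ← jacEntry_eq hd',
      smul_eq_mul, PiLp.single_apply] at h1
    rw [Fin.sum_univ_two, h1]
  have R := h.sum_row_mul_row φ.open_source hx
  simp only [Fin.sum_univ_two] at E R
  have E0 := E i 0
  have E1 := E i 1
  have R0 := R 0 l
  have R1 := R 1 l
  have key : jacEntry φ.symm i 0 (φ x) * (if 0 = l then absJac φ x else 0)
      + jacEntry φ.symm i 1 (φ x) * (if 1 = l then absJac φ x else 0)
      = jacEntry φ l 0 x * (if i = 0 then 1 else 0)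
        + jacEntry φ l 1 x * (if i = 1 then 1 else 0) := by
    rw [← R0, ← R1, ← E0, ← E1]
    ring
  fin_cases l <;> fin_cases i <;> simpa using key

theorem CauchyRiemannOn.symm (h : CauchyRiemannOn s φ φ.source) :
    CauchyRiemannOn s φ.symm φ.target := by
  have hJ : ∀ x ∈ φ.source, absJac φ x ≠ 0 := fun x hx => (h.absJac_pos x hx).ne'
  refine ⟨h.sign, ?_, ?_, ?_, ?_⟩
  · intro y hy
    obtain ⟨A, hA⟩ := h.exists_hasFDerivAt_equiv (φ.map_target hy)
    exact (φ.contDiffAt_symm hy hA (h.smooth.contDiffAt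
      (φ.open_source.mem_nhds (φ.map_target hy)))).contDiffWithinAt
  · intro y hy
    have hx := φ.map_target hy
    rw [← φ.right_inv hy]
    refine mul_right_cancel₀ (hJ _ hx) ?_
    rw [mul_assoc, h.jacEntry_symm_mul hx, h.jacEntry_symm_mul hx, h.eq_diag _ hx]
  · intro y hy
    have hx := φ.map_target hy
    rw [← φ.right_inv hy]
    refine mul_right_cancel₀ (hJ _ hx) ?_
    rw [mul_assoc, h.jacEntry_symm_mul hx, h.jacEntry_symm_mul hx, h.eq_off _ hx]
    linear_combination (-jacEntry φ 0 1 (φ.symm y)) * h.sign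
  · intro y hy
    have hx := φ.map_target hy
    rw [← φ.right_inv hy]
    have h1 := h.absJac_symm_mul hx
    by_contra h0
    rw [le_antisymm (not_lt.1 h0) (abs_nonneg _), zero_mul] at h1
    exact zero_ne_one h1

theorem CauchyRiemannOn.setIntegral_target (h : CauchyRiemannOn s φ φ.source) (F : Plane → ℝ) :
    ∫ y in φ.target, F y = ∫ x in φ.source, absJac φ x * F (φ x) := by
  rw [← φ.image_source_eq_target]
  exact integral_image_eq_integral_abs_det_fderiv_smul volume φ.open_source.measurableSet
    (fun x hx => (h.differentiableAt φ.open_source hx).hasFDerivAt.hasFDerivWithinAt) φ.injOn F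

theorem CauchyRiemannOn.setLIntegral_target (h : CauchyRiemannOn s φ φ.source)
    {A : Set Plane} (hA : MeasurableSet A) (hAs : A ⊆ φ.source) (F : Plane → ℝ≥0∞) :
    ∫⁻ y in φ '' A, F y = ∫⁻ x in A, ENNReal.ofReal (absJac φ x) * F (φ x) :=
  lintegral_image_eq_lintegral_abs_det_fderiv_mul volume hA
    (fun _ hx => (h.differentiableAt φ.open_source (hAs hx)).hasFDerivAt.hasFDerivWithinAt)
    (φ.injOn.mono hAs) F

theorem CauchyRiemannOn.locallyIntegrableOn_comp (h : CauchyRiemannOn s φ φ.source)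
    {w : Plane → ℝ} (hw : LocallyIntegrableOn w φ.target) :
    LocallyIntegrableOn (fun x => w (φ x)) φ.source := by
  rw [locallyIntegrableOn_iff φ.open_source.isLocallyClosed]
  intro K hKs hK
  have h1 : IntegrableOn w (φ '' K) :=
    hw.integrableOn_compact_subset (φ.image_source_eq_target ▸ image_mono hKs)
      (hK.image_of_continuousOn (φ.continuousOn.mono hKs))
  rw [integrableOn_image_iff_integrableOn_abs_det_fderiv_smul volume hK.measurableSet
    (fun x hx => (h.differentiableAt φ.open_source (hKs hx)).hasFDerivAt.hasFDerivWithinAt)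
    (φ.injOn.mono hKs)] at h1
  have hJ : ContinuousOn (fun x => (absJac φ x)⁻¹) K :=
    ((h.continuousOn_absJac φ.open_source).mono hKs).inv₀
      fun x hx => (h.absJac_pos x (hKs hx)).ne'
  refine (h1.continuousOn_mul hJ hK).congr_fun (fun x hx => ?_) hK.measurableSet
  simp only [smul_eq_mul]
  rw [← mul_assoc]
  change (absJac φ x)⁻¹ * absJac φ x * _ = _
  rw [inv_mul_cancel₀ (h.absJac_pos x (hKs hx)).ne', one_mul]

theorem partialDeriv_comp {v : Plane → ℝ} {f : Plane → Plane} {x : Plane}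
    (hv : DifferentiableAt ℝ v (f x)) (hf : DifferentiableAt ℝ f x) (i : Fin 2) :
    partialDeriv i (fun z => v (f z)) x = ∑ k, jacEntry f k i x * partialDeriv k v (f x) := by
  have h1 : HasFDerivAt (fun z => v (f z)) ((fderiv ℝ v (f x)).comp (fderiv ℝ f x)) x :=
    hv.hasFDerivAt.comp x hf.hasFDerivAt
  rw [partialDeriv, h1.fderiv]
  simp only [ContinuousLinearMap.comp_apply, jacEntry_eq hf]
  exact fderiv_plane_apply _ _ _

theorem partialDeriv_mul {a b : Plane → ℝ} {x : Plane} (ha : DifferentiableAt ℝ a x)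
    (hb : DifferentiableAt ℝ b x) (i : Fin 2) :
    partialDeriv i (fun z => a z * b z) x
      = partialDeriv i a x * b x + a x * partialDeriv i b x := by
  rw [partialDeriv, fderiv_fun_mul ha hb]
  simp [partialDeriv]
  ring

end Diffeo

/-! ### Operations on test functions and weak derivatives -/

theorem IsTestFunction.mul_contDiffOn {Ω : Set Plane} {ψ a : Plane → ℝ} (hΩ : IsOpen Ω)
    (hψ : IsTestFunction Ω ψ) (ha : ContDiffOn ℝ ∞ a Ω) :
    IsTestFunction Ω fun x => ψ x * a x := by
  refine ⟨?_, hψ.compact.mul_right, (tsupport_mul_subset_left).trans hψ.support⟩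
  rw [contDiff_iff_contDiffAt]
  intro x
  by_cases hx : x ∈ tsupport ψ
  · exact hψ.smooth.contDiffAt.mul (ha.contDiffAt (hΩ.mem_nhds (hψ.support hx)))
  · refine (contDiffAt_const (c := (0 : ℝ))).congr_of_eventuallyEq ?_
    filter_upwards [(notMem_tsupport_iff_eventuallyEq.1 hx)] with y hy
    simp [hy]

/-- The composition of a test function with a smooth homeomorphism, extended by zero. -/
theorem IsTestFunction.indicator_comp {φ : OpenPartialHomeomorph Plane Plane}
    (hφ : ContDiffOn ℝ ∞ φ φ.source) {v : Plane → ℝ} (hv : IsTestFunction φ.target v) :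
    IsTestFunction φ.source (φ.source.indicator fun x => v (φ x)) := by
  set K := φ.symm '' tsupport v
  have hKc : IsCompact K :=
    IsCompact.image_of_continuousOn hv.compact (φ.continuousOn_symm.mono hv.support)
  have hKs : K ⊆ φ.source := by
    rintro _ ⟨y, hy, rfl⟩
    exact φ.map_target (hv.support hy)
  have hsupp : Function.support (φ.source.indicator fun x => v (φ x)) ⊆ K := by
    intro x hx
    have hxs : x ∈ φ.source := by
      by_contra h0
      exact hx (indicator_of_notMem h0 _)
    rw [Function.mem_support, indicator_of_mem hxs] at hx
    exact ⟨φ x, subset_tsupport v hx, φ.left_inv hxs⟩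
  refine ⟨?_, .of_support_subset_isCompact hKc hsupp,
    (closure_minimal hsupp hKc.isClosed).trans hKs⟩
  rw [contDiff_iff_contDiffAt]
  intro x
  by_cases hx : x ∈ K
  · have hxs := φ.open_source.mem_nhds (hKs hx)
    refine (hv.smooth.contDiffAt.comp x (hφ.contDiffAt hxs)).congr_of_eventuallyEq ?_
    filter_upwards [hxs] with y hy
    simp [hy]
  · refine (contDiffAt_const (c := (0 : ℝ))).congr_of_eventuallyEq ?_
    filter_upwards [hKc.isClosed.isOpen_compl.mem_nhds hx] with y hy
    by_contra h0
    exact hy (hsupp h0)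

theorem LocallyIntegrableOn.contDiffOn_mul {Ω : Set Plane} {a u : Plane → ℝ} (hΩ : IsOpen Ω)
    (ha : ContDiffOn ℝ ∞ a Ω) (hu : LocallyIntegrableOn u Ω) :
    LocallyIntegrableOn (fun x => a x * u x) Ω :=
  hu.continuousOn_mul ha.continuousOn hΩ.isLocallyClosed

theorem IsWeakPartial.mul_contDiffOn {Ω : Set Plane} {i : Fin 2} {a u g : Plane → ℝ}
    (hΩ : IsOpen Ω) (h : IsWeakPartial Ω i u g) (ha : ContDiffOn ℝ ∞ a Ω) :
    IsWeakPartial Ω i (fun x => a x * u x) (fun x => partialDeriv i a x * u x + a x * g x) := by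
  have hpa := contDiffOn_partialDeriv hΩ ha i
  have hau := LocallyIntegrableOn.contDiffOn_mul hΩ ha h.locInt
  have hpu := LocallyIntegrableOn.contDiffOn_mul hΩ hpa h.locInt
  have hag := LocallyIntegrableOn.contDiffOn_mul hΩ ha h.locInt_deriv
  refine ⟨hau, hpu.add hag, fun ψ hψ => ?_⟩
  have h1 := h.integral_eq _ (hψ.mul_contDiffOn hΩ ha)
  have e1 : ∫ x in Ω, partialDeriv i (fun z => ψ z * a z) x * u x
      = ∫ x in Ω, (partialDeriv i ψ x * (a x * u x) + ψ x * (partialDeriv i a x * u x)) := by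
    refine setIntegral_congr_fun hΩ.measurableSet fun x hx => ?_
    rw [partialDeriv_mul (hψ.smooth.differentiable (by simp) x)
      ((ha.contDiffAt (hΩ.mem_nhds hx)).differentiableAt (by simp))]
    ring
  rw [e1, integral_add (hψ.integrableOn_partial_mul i hau) (hψ.integrableOn_mul hpu)] at h1
  have e2 : ∫ x in Ω, ψ x * (partialDeriv i a x * u x + a x * g x)
      = (∫ x in Ω, ψ x * (partialDeriv i a x * u x)) + ∫ x in Ω, ψ x * a x * g x := by
    rw [← integral_add (hψ.integrableOn_mul hpu)
      (by simpa only [mul_assoc, IntegrableOn] using hψ.integrableOn_mul hag)]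
    exact integral_congr_ae (.of_forall fun x => by simp only; ring)
  rw [e2]
  linarith

theorem isWeakPartial_one {Ω : Set Plane} (i : Fin 2) :
    IsWeakPartial Ω i (fun _ => 1) (fun _ => 0) := by
  refine ⟨(locallyIntegrable_const (1 : ℝ)).locallyIntegrableOn Ω, locallyIntegrableOn_zero,
    fun ψ hψ => ?_⟩
  have hc : Continuous (partialDeriv i ψ) :=
    (hψ.smooth.continuous_fderiv (by simp)).clm_apply continuous_const
  have hs : HasCompactSupport (partialDeriv i ψ) := hψ.compact.fderiv_apply (𝕜 := ℝ) _
  have h1 := integral_mul_fderiv_eq_neg_fderiv_mul_of_integrable (μ := volume)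
    (f := fun _ : Plane => (1 : ℝ)) (g := ψ) (v := EuclideanSpace.single i 1)
    (by simp) (by simp only [one_mul]; exact hc.integrable_of_hasCompactSupport hs)
    (by simpa using hψ.smooth.continuous.integrable_of_hasCompactSupport hψ.compact)
    (fun _ _ => differentiableAt_const _) (fun x _ => hψ.smooth.differentiable (by simp) x)
  simp only [mul_one, mul_zero, integral_zero, neg_zero]
  rw [setIntegral_eq_integral_of_forall_compl_eq_zero]
  · simpa [partialDeriv] using h1
  · intro x hx
    by_contra h0
    exact hx (hψ.support (tsupport_fderiv_apply_subset ℝ _ (subset_tsupport _ h0)))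

theorem isWeakPartial_of_contDiffOn {Ω : Set Plane} {u : Plane → ℝ} (hΩ : IsOpen Ω)
    (hu : ContDiffOn ℝ ∞ u Ω) (i : Fin 2) : IsWeakPartial Ω i u (partialDeriv i u) := by
  simpa using (isWeakPartial_one i).mul_contDiffOn hΩ hu

theorem IsWeakPartial.ae_eq {Ω : Set Plane} {i : Fin 2} {u g g' : Plane → ℝ} (hΩ : IsOpen Ω)
    (h : IsWeakPartial Ω i u g) (h' : IsWeakPartial Ω i u g') :
    g =ᵐ[volume.restrict Ω] g' := by
  have h0 := hΩ.ae_eq_zero_of_integral_contDiff_smul_eq_zero (μ := volume)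
    (f := fun x => g x - g' x) (h.locInt_deriv.sub h'.locInt_deriv) fun ψ h1 h2 h3 => ?_
  · rw [EventuallyEq, ae_restrict_iff' hΩ.measurableSet]
    filter_upwards [h0] with x hx hxΩ
    exact sub_eq_zero.1 (hx hxΩ)
  · have hψ : IsTestFunction Ω ψ := ⟨h1, h2, h3⟩
    rw [← setIntegral_eq_integral_of_forall_compl_eq_zero (s := Ω) fun x hx => by
      rw [image_eq_zero_of_notMem_tsupport fun hx' => hx (h3 hx'), zero_smul]]
    simp only [smul_eq_mul, mul_sub]
    rw [integral_sub (hψ.integrableOn_mul h.locInt_deriv) (hψ.integrableOn_mul h'.locInt_deriv)]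
    have := h.integral_eq ψ hψ
    rw [h'.integral_eq ψ hψ] at this
    linarith

/-- Chain rule for weak derivatives under a conformal change of variables. For a test function `ψ`,
with `χ = φ⁻¹`, the divergence of the field `((ψ ∘ χ) ∂ₖ χᵢ)ₖ` is `(∂ᵢ ψ ∘ χ) |det Dχ|`, since `χᵢ`
is harmonic and the rows of `Dχ` are orthogonal. -/
theorem IsWeakPartial.comp {s : ℝ} {φ : OpenPartialHomeomorph Plane Plane}
    (h : CauchyRiemannOn s φ φ.source) {w : Plane → ℝ} {g : Fin 2 → Plane → ℝ}
    (hw : ∀ k, IsWeakPartial φ.target k w (g k)) (i : Fin 2) :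
    IsWeakPartial φ.source i (fun x => w (φ x)) (fun x => ∑ k, jacEntry φ k i x * g k (φ x)) := by
  have h' := h.symm
  have hloc : ∀ k, LocallyIntegrableOn (fun x => jacEntry φ k i x * g k (φ x)) φ.source := fun k =>
    LocallyIntegrableOn.contDiffOn_mul φ.open_source (h.contDiffOn_jacEntry φ.open_source k i)
      (h.locallyIntegrableOn_comp (hw k).locInt_deriv)
  refine ⟨h.locallyIntegrableOn_comp (hw 0).locInt, ?_, fun ψ hψ => ?_⟩
  · simp only [Fin.sum_univ_two]
    exact (hloc 0).add (hloc 1)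
  set χ := φ.symm with hχ
  set v : Plane → ℝ := φ.target.indicator fun y => ψ (χ y) with hv
  have hvt : IsTestFunction φ.target v := by
    have := IsTestFunction.indicator_comp (φ := φ.symm) h'.smooth (v := ψ) (by simpa using hψ)
    simpa using this
  have ht : ∀ k, IsTestFunction φ.target fun y => v y * jacEntry χ i k y := fun k =>
    hvt.mul_contDiffOn φ.open_target (h'.contDiffOn_jacEntry φ.open_target i k)
  have hdiv : ∀ y ∈ φ.target, ∑ k, partialDeriv k (fun y => v y * jacEntry χ i k y) y
      = partialDeriv i ψ (χ y) * absJac χ y := by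
    intro y hy
    have hpv : ∀ k, partialDeriv k v y = ∑ j, jacEntry χ j k y * partialDeriv j ψ (χ y) := by
      intro k
      rw [partialDeriv_congr φ.open_target (v := fun y => ψ (χ y))
        (fun z hz => by simp [hv, hz]) hy]
      exact partialDeriv_comp (hψ.smooth.differentiable (by simp) _)
        (h'.differentiableAt φ.open_target hy) k
    have hpm : ∀ k, partialDeriv k (fun y => v y * jacEntry χ i k y) y
        = partialDeriv k v y * jacEntry χ i k y + v y * partialDeriv k (jacEntry χ i k) y :=
      fun k => partialDeriv_mul (hvt.smooth.differentiable (by simp) _)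
        (((h'.contDiffOn_jacEntry φ.open_target i k).contDiffAt
          (φ.open_target.mem_nhds hy)).differentiableAt (by simp)) k
    have hharm := h'.harmonic φ.open_target hy i
    have hrow := fun j => h'.sum_row_mul_row φ.open_target hy i j
    have hr0 := hrow 0
    have hr1 := hrow 1
    simp only [Fin.sum_univ_two] at hharm hr0 hr1 hpv ⊢
    rw [hpm, hpm, hpv, hpv]
    have : partialDeriv i ψ (χ y) * absJac χ y
        = partialDeriv 0 ψ (χ y) * (if i = 0 then absJac χ y else 0)
          + partialDeriv 1 ψ (χ y) * (if i = 1 then absJac χ y else 0) := by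
      fin_cases i <;> simp
    rw [this, ← hr0, ← hr1]
    linear_combination v y * hharm
  have L1 : ∫ x in φ.source, partialDeriv i ψ x * w (φ x)
      = ∫ y in φ.target, ∑ k, partialDeriv k (fun y => v y * jacEntry χ i k y) y * w y := by
    rw [h.setIntegral_target]
    refine setIntegral_congr_fun φ.open_source.measurableSet fun x hx => ?_
    rw [← Finset.sum_mul, hdiv _ (φ.map_source hx), hχ, φ.left_inv hx]
    linear_combination (-(partialDeriv i ψ x * w (φ x))) * h.absJac_symm_mul hx
  have L2 : ∫ x in φ.source, ψ x * ∑ k, jacEntry φ k i x * g k (φ x)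
      = ∫ y in φ.target, ∑ k, v y * jacEntry χ i k y * g k y := by
    rw [h.setIntegral_target]
    refine setIntegral_congr_fun φ.open_source.measurableSet fun x hx => ?_
    simp only [Finset.mul_sum]
    refine Finset.sum_congr rfl fun k _ => ?_
    rw [← h.jacEntry_symm_mul hx, hv, indicator_of_mem (φ.map_source hx), hχ, φ.left_inv hx]
    ring
  rw [L1, L2, integral_finsetSum _ fun k _ => (ht k).integrableOn_partial_mul k (hw k).locInt,
    integral_finsetSum _ fun k _ => (ht k).integrableOn_mul (hw k).locInt_deriv,
    ← Finset.sum_neg_distrib]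
  exact Finset.sum_congr rfl fun k _ => (hw k).integral_eq _ (ht k)

/-! ### Composition and multiplication operators on `L^p` -/

section Operators

theorem aestronglyMeasurable_comp_of_map_le {Ω Ω' : Set Plane} {f : Plane → Plane} {K : ℝ≥0∞}
    (hf : AEMeasurable f (volume.restrict Ω))
    (hle : (volume.restrict Ω).map f ≤ K • volume.restrict Ω')
    {v : Plane → ℝ} (hv : AEStronglyMeasurable v (volume.restrict Ω')) :
    AEStronglyMeasurable (fun x => v (f x)) (volume.restrict Ω) :=
  (hv.mono_ac (Measure.absolutelyContinuous_of_le_smul hle)).comp_aemeasurable hf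

theorem ae_comp_of_map_le {Ω Ω' : Set Plane} {f : Plane → Plane} {K : ℝ≥0∞}
    (hf : AEMeasurable f (volume.restrict Ω))
    (hle : (volume.restrict Ω).map f ≤ K • volume.restrict Ω')
    {P : Plane → Prop} (hP : ∀ᵐ y ∂(volume.restrict Ω'), P y) :
    ∀ᵐ x ∂(volume.restrict Ω), P (f x) :=
  ae_of_ae_map hf ((Measure.absolutelyContinuous_of_le_smul hle).ae_le hP)

theorem eLpNorm_comp_le_of_map_le {p : ℝ≥0∞} (hp : p ≠ ⊤) {Ω Ω' : Set Plane} {f : Plane → Plane}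
    {K : ℝ≥0∞} (hf : AEMeasurable f (volume.restrict Ω))
    (hle : (volume.restrict Ω).map f ≤ K • volume.restrict Ω')
    {v : Plane → ℝ} (hv : AEStronglyMeasurable v (volume.restrict Ω')) :
    eLpNorm (fun x => v (f x)) p (volume.restrict Ω)
      ≤ K ^ (1 / p).toReal * eLpNorm v p (volume.restrict Ω') := by
  have h1 := eLpNorm_map_measure (p := p)
    (hv.mono_ac (Measure.absolutelyContinuous_of_le_smul hle)) hf
  calc eLpNorm (fun x => v (f x)) p (volume.restrict Ω)
      = eLpNorm v p ((volume.restrict Ω).map f) := h1.symm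
    _ ≤ eLpNorm v p (K • volume.restrict Ω') := eLpNorm_mono_measure v hle
    _ = K ^ (1 / p).toReal * eLpNorm v p (volume.restrict Ω') := by
      rw [eLpNorm_smul_measure_of_ne_top hp, smul_eq_mul]

variable {p : ℝ≥0∞} [Fact (1 ≤ p)]

/-- A linear map between `L^p` spaces given by an operation on functions that satisfies a norm
bound is a bounded operator. -/
theorem exists_clm_of_eLpNorm_le {Ω Ω' : Set Plane} (A : (Plane → ℝ) → Plane → ℝ) {K : ℝ≥0∞}
    (hK : K ≠ ⊤)
    (hmeas : ∀ v : LpSpace p Ω', AEStronglyMeasurable (A v) (volume.restrict Ω))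
    (hle : ∀ v : LpSpace p Ω',
      eLpNorm (A v) p (volume.restrict Ω) ≤ K * eLpNorm v p (volume.restrict Ω'))
    (hadd : ∀ v w : LpSpace p Ω', A (v + w : LpSpace p Ω') =ᵐ[volume.restrict Ω] A v + A w)
    (hsmul : ∀ (c : ℝ) (v : LpSpace p Ω'),
      A (c • v : LpSpace p Ω') =ᵐ[volume.restrict Ω] c • A v) :
    ∃ S : LpSpace p Ω' →L[ℝ] LpSpace p Ω, (∀ v, S v =ᵐ[volume.restrict Ω] A v) ∧
      ∀ v, ‖S v‖ₑ ≤ K * ‖v‖ₑ := by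
  have hmem : ∀ v : LpSpace p Ω', MemLp (A v) p (volume.restrict Ω) := fun v =>
    ⟨hmeas v, (hle v).trans_lt (ENNReal.mul_lt_top hK.lt_top (Lp.eLpNorm_lt_top v))⟩
  let S₀ : LpSpace p Ω' →ₗ[ℝ] LpSpace p Ω :=
    { toFun := fun v => (hmem v).toLp
      map_add' := fun v w => by
        rw [← MemLp.toLp_add]
        exact MemLp.toLp_congr _ _ (hadd v w)
      map_smul' := fun c v => by
        rw [RingHom.id_apply, ← MemLp.toLp_const_smul]
        exact MemLp.toLp_congr _ _ (hsmul c v) }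
  have hS₀ : ∀ v, S₀ v =ᵐ[volume.restrict Ω] A v := fun v => (hmem v).coeFn_toLp
  have hb : ∀ v, ‖S₀ v‖ₑ ≤ K * ‖v‖ₑ := fun v => by
    rw [Lp.enorm_def, Lp.enorm_def, eLpNorm_congr_ae (hS₀ v)]
    exact hle v
  refine ⟨S₀.mkContinuous K.toReal fun v => ?_, hS₀, hb⟩
  have := ENNReal.toReal_mono (ENNReal.mul_ne_top hK enorm_ne_top) (hb v)
  simpa [ENNReal.toReal_mul] using this

theorem exists_compositionOperator (hp : p ≠ ⊤) {Ω Ω' : Set Plane} {f : Plane → Plane} {K : ℝ≥0∞}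
    (hK : K ≠ ⊤) (hf : AEMeasurable f (volume.restrict Ω))
    (hle : (volume.restrict Ω).map f ≤ K • volume.restrict Ω') :
    ∃ S : LpSpace p Ω' →L[ℝ] LpSpace p Ω, IsCompositionOperator f S ∧
      ∀ v, ‖S v‖ₑ ≤ K ^ (1 / p).toReal * ‖v‖ₑ := by
  refine exists_clm_of_eLpNorm_le (fun v x => v (f x))
    (ENNReal.rpow_ne_top_of_nonneg ENNReal.toReal_nonneg hK)
    (fun v => aestronglyMeasurable_comp_of_map_le hf hle (Lp.aestronglyMeasurable v))
    (fun v => eLpNorm_comp_le_of_map_le hp hf hle (Lp.aestronglyMeasurable v)) ?_ ?_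
  · exact fun v w => ae_comp_of_map_le hf hle (Lp.coeFn_add v w)
  · exact fun c v => ae_comp_of_map_le hf hle (Lp.coeFn_smul c v)

theorem exists_multiplicationOperator {Ω : Set Plane} {a : Plane → ℝ} {B : ℝ}
    (ha : AEStronglyMeasurable a (volume.restrict Ω))
    (hB : ∀ᵐ x ∂(volume.restrict Ω), ‖a x‖ ≤ B) :
    ∃ M : LpSpace p Ω →L[ℝ] LpSpace p Ω, ∀ f, M f =ᵐ[volume.restrict Ω] fun x => a x * f x := by
  refine Exists.imp (fun _ hM => hM.1) (exists_clm_of_eLpNorm_le (p := p) (Ω := Ω) (Ω' := Ω)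
    (fun f x => a x * f x) (K := ENNReal.ofReal B) ENNReal.ofReal_ne_top
    (fun f => ha.mul (Lp.aestronglyMeasurable f)) (fun f => ?_) (fun f g => ?_) (fun c f => ?_))
  · refine eLpNorm_le_mul_eLpNorm_of_ae_le_mul ?_ p
    filter_upwards [hB] with x hx
    rw [norm_mul]
    exact mul_le_mul_of_nonneg_right hx (norm_nonneg _)
  · filter_upwards [Lp.coeFn_add f g] with x hx
    simp only [hx, Pi.add_apply, mul_add]
  · filter_upwards [Lp.coeFn_smul c f] with x hx
    simp only [hx, Pi.smul_apply, smul_eq_mul]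
    ring

end Operators

section Pullback

variable {s : ℝ} {φ : OpenPartialHomeomorph Plane Plane} {p : ℝ≥0∞}

theorem coeFn_add_congr {Ω : Set Plane} {f g : LpSpace p Ω} {a b : Plane → ℝ}
    (hf : f =ᵐ[volume.restrict Ω] a) (hg : g =ᵐ[volume.restrict Ω] b) :
    (f + g : LpSpace p Ω) =ᵐ[volume.restrict Ω] fun x => a x + b x :=
  (Lp.coeFn_add f g).trans (hf.add hg)

theorem coeFn_sum_congr {Ω : Set Plane} {f : Fin 2 → LpSpace p Ω} {a : Fin 2 → Plane → ℝ}
    (hf : ∀ k, f k =ᵐ[volume.restrict Ω] a k) :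
    (∑ k, f k : LpSpace p Ω) =ᵐ[volume.restrict Ω] fun x => ∑ k, a k x := by
  simp only [Fin.sum_univ_two]
  exact coeFn_add_congr (hf 0) (hf 1)

theorem aemeasurable_restrict_source (φ : OpenPartialHomeomorph Plane Plane) :
    AEMeasurable φ (volume.restrict φ.source) :=
  φ.continuousOn.aemeasurable φ.open_source.measurableSet

theorem CauchyRiemannOn.map_restrict_le (h : CauchyRiemannOn s φ φ.source) {m : ℝ≥0∞}
    (hm : ∀ x ∈ φ.source, m ≤ ENNReal.ofReal (absJac φ x)) (hm0 : m ≠ 0) (hmt : m ≠ ⊤) :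
    (volume.restrict φ.source).map φ ≤ m⁻¹ • volume.restrict φ.target := by
  refine Measure.le_iff.2 fun A hA => ?_
  have hind : Measurable (A.indicator (1 : Plane → ℝ≥0∞)) := measurable_one.indicator hA
  rw [Measure.smul_apply, smul_eq_mul, ← lintegral_indicator_one hA, ← lintegral_indicator_one hA,
    lintegral_map' hind.aemeasurable (aemeasurable_restrict_source φ),
    ← φ.image_source_eq_target,
    h.setLIntegral_target φ.open_source.measurableSet subset_rfl,
    ← ENNReal.mul_le_iff_le_inv hm0 hmt, ← lintegral_const_mul' _ _ hmt]
  refine lintegral_mono_ae ?_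
  filter_upwards [ae_restrict_mem φ.open_source.measurableSet] with x hx
  exact mul_le_mul_left (hm x hx) _

theorem mem_Xp_iff [Fact (1 ≤ p)] {Ω : Set Plane}
    {z : LpSpace p Ω × (Fin 2 → LpSpace p Ω) × (Fin 2 → Fin 2 → LpSpace p Ω)} :
    z ∈ Xp p Ω ↔ (∀ i, IsWeakPartial Ω i z.1 (z.2.1 i)) ∧
      (∀ i j, IsWeakPartial Ω j (z.2.1 i) (z.2.2 i j)) ∧ (z.1, z.2.1) ∈ W01p p Ω :=
  ⟨fun h => ⟨h.1.1, h.1.2, h.2⟩, fun h => ⟨⟨h.1, h.2.1⟩, h.2.2⟩⟩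

theorem laplacian_apply [Fact (1 ≤ p)] {Ω : Set Plane} (z : Xp p Ω) :
    laplacian p Ω z = ∑ i, z.1.2.2 i i := by
  rw [laplacian, _root_.sum_apply]
  rfl

/-- Composition with `φ` maps `W₀^{1,p}` of the target to `W₀^{1,p}` of the source: it is bounded
in the `W^{1,p}` norm and preserves test functions. -/
theorem CauchyRiemannOn.exists_comp_mem_W01p [Fact (1 ≤ p)] (h : CauchyRiemannOn s φ φ.source)
    (hp : p ≠ ⊤) {m : ℝ≥0∞} (hm : ∀ x ∈ φ.source, m ≤ ENNReal.ofReal (absJac φ x)) (hm0 : m ≠ 0)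
    (hmt : m ≠ ⊤) {B : ℝ}
    (hB₁ : ∀ k i, ∀ᵐ x ∂(volume.restrict φ.source), ‖jacEntry φ k i x‖ ≤ B)
    {q : LpSpace p φ.target × (Fin 2 → LpSpace p φ.target)} (hq : q ∈ W01p p φ.target) :
    ∃ r ∈ W01p p φ.source, (r.1 =ᵐ[volume.restrict φ.source] fun x => q.1 (φ x)) ∧
      ∀ i, r.2 i =ᵐ[volume.restrict φ.source] fun x => ∑ k, jacEntry φ k i x * q.2 k (φ x) := by
  have hΩ := φ.open_source
  have hφm := aemeasurable_restrict_source φ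
  have hle := h.map_restrict_le hm hm0 hmt
  obtain ⟨S, hS, -⟩ := exists_compositionOperator (p := p) hp (ENNReal.inv_ne_top.2 hm0) hφm hle
  have hM : ∀ k i, ∃ M : LpSpace p φ.source →L[ℝ] LpSpace p φ.source,
      ∀ f, M f =ᵐ[volume.restrict φ.source] fun x => jacEntry φ k i x * f x := fun k i =>
    exists_multiplicationOperator ((h.contDiffOn_jacEntry hΩ k i).continuousOn.aestronglyMeasurable
      hΩ.measurableSet) (hB₁ k i)
  choose M hM using hM
  -- the pullback of a function and its gradient
  let Θ : LpSpace p φ.target × (Fin 2 → LpSpace p φ.target) →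
      LpSpace p φ.source × (Fin 2 → LpSpace p φ.source) :=
    fun q => (S q.1, fun i => ∑ k, M k i (S (q.2 k)))
  have hΘ : Continuous Θ := by fun_prop
  have hΘ1 : ∀ q, (Θ q).1 =ᵐ[volume.restrict φ.source] fun x => q.1 (φ x) := fun q => hS q.1
  have hΘ2 : ∀ q i, (Θ q).2 i =ᵐ[volume.restrict φ.source]
      fun x => ∑ k, jacEntry φ k i x * q.2 k (φ x) := fun q i =>
    coeFn_sum_congr fun k => (hM k i (S (q.2 k))).trans
      ((hS (q.2 k)).mono fun x hx => by simp only [hx])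
  have hΘtest : ∀ q ∈ testPairs p φ.target, Θ q ∈ testPairs p φ.source := by
    rintro q ⟨v, hv, h1, h2⟩
    refine ⟨_, hv.indicator_comp h.smooth, ?_, fun i => ?_⟩
    · filter_upwards [hΘ1 q, ae_comp_of_map_le hφm hle h1,
        ae_restrict_mem hΩ.measurableSet] with x hx1 hx2 hx3
      rw [hx1, hx2, indicator_of_mem hx3]
    · have h2' : ∀ k, ∀ᵐ x ∂(volume.restrict φ.source), q.2 k (φ x) = partialDeriv k v (φ x) :=
        fun k => ae_comp_of_map_le hφm hle (h2 k)
      filter_upwards [hΘ2 q i, ae_all_iff.2 h2', ae_restrict_mem hΩ.measurableSet]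
        with x hx1 hx2 hx3
      rw [hx1, partialDeriv_congr hΩ (v := fun x => v (φ x))
        (fun y hy => indicator_of_mem hy _) hx3,
        partialDeriv_comp (hv.smooth.differentiable (by simp) _) (h.differentiableAt hΩ hx3)]
      simp only [hx2]
  exact ⟨Θ q, map_mem_closure hΘ hq hΘtest, hΘ1 q, hΘ2 q⟩

/-- Chain rule for second weak derivatives in `L^p`. -/
theorem CauchyRiemannOn.exists_secondDeriv_comp [Fact (1 ≤ p)] (h : CauchyRiemannOn s φ φ.source)
    (hp : p ≠ ⊤) {m : ℝ≥0∞} (hm : ∀ x ∈ φ.source, m ≤ ENNReal.ofReal (absJac φ x)) (hm0 : m ≠ 0)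
    (hmt : m ≠ ⊤) {B : ℝ}
    (hB₁ : ∀ k i, ∀ᵐ x ∂(volume.restrict φ.source), ‖jacEntry φ k i x‖ ≤ B)
    (hB₂ : ∀ k i j, ∀ᵐ x ∂(volume.restrict φ.source), ‖partialDeriv j (jacEntry φ k i) x‖ ≤ B)
    {g : Fin 2 → LpSpace p φ.target} {H : Fin 2 → Fin 2 → LpSpace p φ.target}
    (hw : ∀ i j, IsWeakPartial φ.target j (g i) (H i j)) (i j : Fin 2) :
    ∃ G : LpSpace p φ.source,
      (G =ᵐ[volume.restrict φ.source] fun x => ∑ k, (partialDeriv j (jacEntry φ k i) x * g k (φ x)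
        + jacEntry φ k i x * ∑ l, jacEntry φ l j x * H k l (φ x))) ∧
      IsWeakPartial φ.source j (fun x => ∑ k, jacEntry φ k i x * g k (φ x)) G := by
  have hΩ := φ.open_source
  have hφm := aemeasurable_restrict_source φ
  have hle := h.map_restrict_le hm hm0 hmt
  have hsm := h.contDiffOn_jacEntry hΩ
  obtain ⟨S, hS, -⟩ := exists_compositionOperator (p := p) hp (ENNReal.inv_ne_top.2 hm0) hφm hle
  have hM : ∀ k i, ∃ M : LpSpace p φ.source →L[ℝ] LpSpace p φ.source,
      ∀ f, M f =ᵐ[volume.restrict φ.source] fun x => jacEntry φ k i x * f x := fun k i =>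
    exists_multiplicationOperator
      ((hsm k i).continuousOn.aestronglyMeasurable hΩ.measurableSet) (hB₁ k i)
  have hN : ∀ k, ∃ M : LpSpace p φ.source →L[ℝ] LpSpace p φ.source,
      ∀ f, M f =ᵐ[volume.restrict φ.source]
        fun x => partialDeriv j (jacEntry φ k i) x * f x := fun k =>
    exists_multiplicationOperator
      ((contDiffOn_partialDeriv hΩ (hsm k i) j).continuousOn.aestronglyMeasurable
        hΩ.measurableSet) (hB₂ k i j)
  choose M hM using hM
  choose N hN using hN
  have hMS : ∀ k i (v : LpSpace p φ.target), M k i (S v) =ᵐ[volume.restrict φ.source]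
      fun x => jacEntry φ k i x * v (φ x) := fun k i v =>
    (hM k i (S v)).trans ((hS v).mono fun x hx => by simp only [hx])
  have hNS : ∀ k (v : LpSpace p φ.target), N k (S v) =ᵐ[volume.restrict φ.source]
      fun x => partialDeriv j (jacEntry φ k i) x * v (φ x) := fun k v =>
    (hN k (S v)).trans ((hS v).mono fun x hx => by simp only [hx])
  have hG : (∑ k, (N k (S (g k)) + M k i (∑ l, M l j (S (H k l)))) : LpSpace p φ.source)
      =ᵐ[volume.restrict φ.source] fun x =>
      ∑ k, (partialDeriv j (jacEntry φ k i) x * g k (φ x)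
        + jacEntry φ k i x * ∑ l, jacEntry φ l j x * H k l (φ x)) := by
    refine coeFn_sum_congr fun k => coeFn_add_congr (hNS k (g k)) ?_
    refine (hM k i _).trans ?_
    filter_upwards [coeFn_sum_congr fun l => hMS l j (H k l)] with x hx
    rw [hx]
  refine ⟨_, hG, IsWeakPartial.congr ?_ ae_eq_rfl hG.symm⟩
  have hk : ∀ k, IsWeakPartial φ.source j (fun x => jacEntry φ k i x * g k (φ x))
      (fun x => partialDeriv j (jacEntry φ k i) x * g k (φ x)
        + jacEntry φ k i x * ∑ l, jacEntry φ l j x * H k l (φ x)) := fun k =>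
    (IsWeakPartial.comp h (hw k) j).mul_contDiffOn hΩ (hsm k i)
  simp only [Fin.sum_univ_two (f := fun k => jacEntry φ k i _ * _),
    Fin.sum_univ_two (f := fun k => partialDeriv j (jacEntry φ k i) _ * _ + _)]
  exact (hk 0).add (hk 1)

/-- Conformal invariance of the Dirichlet Laplacian: composition with `φ` maps `X_p` of the target
to `X_p` of the source, and `Δ (w ∘ φ) = |det Dφ| (Δ w) ∘ φ`. -/
theorem CauchyRiemannOn.exists_comp_mem_Xp [Fact (1 ≤ p)] (h : CauchyRiemannOn s φ φ.source)
    (hp : p ≠ ⊤) {m : ℝ≥0∞} (hm : ∀ x ∈ φ.source, m ≤ ENNReal.ofReal (absJac φ x)) (hm0 : m ≠ 0)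
    (hmt : m ≠ ⊤) {B : ℝ}
    (hB₁ : ∀ k i, ∀ᵐ x ∂(volume.restrict φ.source), ‖jacEntry φ k i x‖ ≤ B)
    (hB₂ : ∀ k i j, ∀ᵐ x ∂(volume.restrict φ.source), ‖partialDeriv j (jacEntry φ k i) x‖ ≤ B)
    (w : Xp p φ.target) :
    ∃ z : Xp p φ.source,
      (inclusion p φ.source z =ᵐ[volume.restrict φ.source]
        fun x => inclusion p φ.target w (φ x)) ∧
      (laplacian p φ.source z =ᵐ[volume.restrict φ.source]
        fun x => absJac φ x * laplacian p φ.target w (φ x)) := by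
  have hΩ := φ.open_source
  obtain ⟨⟨u, g, H⟩, hw⟩ := w
  obtain ⟨hw1, hw2, hw3⟩ := mem_Xp_iff.1 hw
  obtain ⟨⟨u', g'⟩, hr, hr1, hr2⟩ := h.exists_comp_mem_W01p hp hm hm0 hmt hB₁ hw3
  have hG := h.exists_secondDeriv_comp hp hm hm0 hmt hB₁ hB₂ hw2
  choose G hG hGw using hG
  refine ⟨⟨(u', g', G), mem_Xp_iff.2 ⟨fun i => ?_, fun i j => ?_, hr⟩⟩, hr1, ?_⟩
  · exact (IsWeakPartial.comp h hw1 i).congr hr1.symm (hr2 i).symm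
  · exact (hGw i j).congr (hr2 i).symm ae_eq_rfl
  · rw [laplacian_apply, laplacian_apply]
    have hH := ae_comp_of_map_le (aemeasurable_restrict_source φ) (h.map_restrict_le hm hm0 hmt)
      (coeFn_sum_congr (f := fun i => H i i) fun i => ae_eq_rfl)
    filter_upwards [coeFn_sum_congr fun i => hG i i, hH, ae_restrict_mem hΩ.measurableSet]
      with x hx1 hx2 hx3
    rw [hx1, hx2]
    have hh0 := h.harmonic hΩ hx3 0
    have hh1 := h.harmonic hΩ hx3 1
    have hr := h.sum_row_mul_row hΩ hx3
    have hr00 := hr 0 0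
    have hr01 := hr 0 1
    have hr11 := hr 1 1
    simp only [Fin.sum_univ_two, if_true, Fin.zero_eq_one_iff, OfNat.ofNat_ne_one, if_false]
      at hh0 hh1 hr00 hr01 hr11 ⊢
    linear_combination g 0 (φ x) * hh0 + g 1 (φ x) * hh1 + H 0 0 (φ x) * hr00
      + (H 0 1 (φ x) + H 1 0 (φ x)) * hr01 + H 1 1 (φ x) * hr11

end Pullback

/-! ### Bounds on the derivatives of an admissible conformal map -/

section Admissible

theorem exists_ae_bound {ι : Type*} [Finite ι] {μ : Measure Plane} {f : ι → Plane → ℝ}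
    (hf : ∀ i, MemLp (f i) ∞ μ) : ∃ L, 0 ≤ L ∧ ∀ i, ∀ᵐ x ∂μ, ‖f i x‖ ≤ L := by
  have := Fintype.ofFinite ι
  refine ⟨∑ i, (eLpNormEssSup (f i) μ).toReal, Finset.sum_nonneg fun i _ => ENNReal.toReal_nonneg,
    fun i => ?_⟩
  have htop : eLpNormEssSup (f i) μ ≠ ⊤ := by
    rw [← eLpNorm_exponent_top]
    exact (hf i).eLpNorm_ne_top
  filter_upwards [ae_le_eLpNormEssSup (f := f i) (μ := μ)] with x hx
  have h1 : ‖f i x‖ ≤ (eLpNormEssSup (f i) μ).toReal := by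
    simpa using ENNReal.toReal_mono htop hx
  exact h1.trans (Finset.single_le_sum (f := fun i => (eLpNormEssSup (f i) μ).toReal)
    (fun i _ => ENNReal.toReal_nonneg) (Finset.mem_univ i))

theorem forall_le_of_ae_le {Ω : Set Plane} (hΩ : IsOpen Ω) {a : Plane → ℝ}
    (ha : ContinuousOn a Ω) {B : ℝ} (h : ∀ᵐ x ∂(volume.restrict Ω), a x ≤ B) :
    ∀ x ∈ Ω, a x ≤ B := by
  intro x hx
  by_contra hlt
  have hopen : IsOpen (Ω ∩ a ⁻¹' Ioi B) := ha.isOpen_inter_preimage hΩ isOpen_Ioi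
  rw [ae_restrict_iff' hΩ.measurableSet, ae_iff] at h
  have h0 : volume (Ω ∩ a ⁻¹' Ioi B) = 0 :=
    measure_mono_null
      (fun y hy (hcon : y ∈ Ω → a y ≤ B) => not_le.2 (mem_Ioi.1 hy.2) (hcon hy.1)) h
  have hempty := hopen.measure_eq_zero_iff volume |>.1 h0
  exact (hempty ▸ (⟨hx, not_le.1 hlt⟩ : x ∈ Ω ∩ a ⁻¹' Ioi B) : x ∈ (∅ : Set Plane))

variable {p : ℝ≥0∞} [Fact (1 ≤ p)] {φ : OpenPartialHomeomorph Plane Plane}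

/-- A conformal admissible map is holomorphic or antiholomorphic, its derivatives of orders one and
two are bounded, and its Jacobian determinant is bounded away from zero. -/
theorem IsAdmissible.exists_cauchyRiemannOn_bounds (hadm : IsAdmissible p φ.source φ φ.target)
    (hconn : IsPreconnected φ.source) (hc : ∀ x ∈ φ.source, ConformalAt φ x) :
    ∃ s c B : ℝ, CauchyRiemannOn s φ φ.source ∧ 0 < c ∧ 0 < B ∧
      (∀ x ∈ φ.source, c ≤ absJac φ x) ∧ (∀ x ∈ φ.source, absJac φ x ≤ B) ∧
      (∀ k i, ∀ᵐ x ∂(volume.restrict φ.source), ‖jacEntry φ k i x‖ ≤ B) ∧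
      ∀ k i j, ∀ᵐ x ∂(volume.restrict φ.source), ‖partialDeriv j (jacEntry φ k i) x‖ ≤ B := by
  have hΩ := φ.open_source
  obtain ⟨D, H, hD, hH, hDb, hHb, c, hc0, hdet⟩ := hadm.exists_weakDeriv
  obtain ⟨L₁, hL₁, hDL⟩ := exists_ae_bound (f := fun q : Fin 2 × Fin 2 => D q.1 q.2)
    fun q => hDb q.1 q.2
  obtain ⟨L₂, hL₂, hHL⟩ := exists_ae_bound (f := fun q : Fin 2 × Fin 2 × Fin 2 =>
    H q.1 q.2.1 q.2.2) fun q => hHb q.1 q.2.1 q.2.2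
  have hdiff : ∀ k, ∀ x ∈ φ.source, DifferentiableAt ℝ (fun x => φ x k) x := fun k x hx =>
    (EuclideanSpace.proj k : Plane →L[ℝ] ℝ).differentiableAt.comp x (hc x hx).differentiableAt
  obtain ⟨s, hs⟩ := exists_cauchyRiemannOn hΩ hconn hc fun k i =>
    continuousOn_partialDeriv hΩ (hdiff k) (hD k) (hH k) hL₂ (fun i j => hHL (k, i, j)) i
  have hDe : ∀ k i, D k i =ᵐ[volume.restrict φ.source] jacEntry φ k i := fun k i =>
    (hD k i).ae_eq hΩ (isWeakPartial_of_contDiffOn hΩ (hs.contDiffOn_coord k) i)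
  have hHe : ∀ k i j, H k i j =ᵐ[volume.restrict φ.source] partialDeriv j (jacEntry φ k i) :=
    fun k i j => ((hH k i j).congr (hDe k i) ae_eq_rfl).ae_eq hΩ
      (isWeakPartial_of_contDiffOn hΩ (hs.contDiffOn_jacEntry hΩ k i) j)
  have hJb : ∀ k i, ∀ᵐ x ∂(volume.restrict φ.source), ‖jacEntry φ k i x‖ ≤ L₁ := fun k i => by
    filter_upwards [hDL (k, i), hDe k i] with x hx hx'
    rwa [← hx']
  have hJc := hs.continuousOn_absJac hΩ
  refine ⟨s, c, L₁ + L₂ + 2 * L₁ ^ 2 + 1, hs, hc0, by positivity, fun x hx => ?_,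
    forall_le_of_ae_le hΩ hJc ?_, fun k i => ?_, fun k i j => ?_⟩
  · refine neg_le_neg_iff.1 (forall_le_of_ae_le hΩ hJc.neg ?_ x hx)
    filter_upwards [hdet, ae_all_iff.2 fun k => ae_all_iff.2 (hDe k),
      ae_restrict_mem hΩ.measurableSet] with x h1 h2 h3
    rw [Pi.neg_apply, neg_le_neg_iff, absJac_eq_abs (hs.differentiableAt hΩ h3)]
    simpa [Matrix.det_fin_two, h2] using h1
  · filter_upwards [hJb 0 0, hJb 0 1, ae_restrict_mem hΩ.measurableSet] with x h1 h2 h3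
    rw [hs.absJac_eq hΩ h3]
    have h1' := pow_le_pow_left₀ (norm_nonneg _) h1 2
    have h2' := pow_le_pow_left₀ (norm_nonneg _) h2 2
    rw [Real.norm_eq_abs, sq_abs] at h1' h2'
    linarith
  · filter_upwards [hJb k i] with x hx
    nlinarith [sq_nonneg L₁]
  · filter_upwards [hHL (k, i, j), hHe k i j] with x hx hx'
    rw [← hx']
    change ‖H k i j x‖ ≤ L₂ at hx
    nlinarith [sq_nonneg L₁]

end Admissible

/-! ### Comparison of the inverse Laplacians -/

section Comparison

variable {s : ℝ} {p : ℝ≥0∞} [Fact (1 ≤ p)] {φ : OpenPartialHomeomorph Plane Plane}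

/-- The conjugated inverse Laplacian is the inverse Laplacian of the source preceded by
multiplication by `|det Dφ|`. -/
theorem CauchyRiemannOn.comp_inverseLaplacian_comp (h : CauchyRiemannOn s φ φ.source) (hp : p ≠ ⊤)
    {m : ℝ≥0∞} (hm : ∀ x ∈ φ.source, m ≤ ENNReal.ofReal (absJac φ x)) (hm0 : m ≠ 0) (hmt : m ≠ ⊤)
    {B : ℝ} (hB₁ : ∀ k i, ∀ᵐ x ∂(volume.restrict φ.source), ‖jacEntry φ k i x‖ ≤ B)
    (hB₂ : ∀ k i j, ∀ᵐ x ∂(volume.restrict φ.source), ‖partialDeriv j (jacEntry φ k i) x‖ ≤ B)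
    (hsrc : (laplacian p φ.source).IsInvertible) (htgt : (laplacian p φ.target).IsInvertible)
    {C : LpSpace p φ.target →L[ℝ] LpSpace p φ.source} (hC : IsCompositionOperator φ C)
    {C' : LpSpace p φ.source →L[ℝ] LpSpace p φ.target} (hC' : IsCompositionOperator φ.symm C')
    {f f' : LpSpace p φ.source}
    (hf : f' =ᵐ[volume.restrict φ.source] fun x => absJac φ x * f x) :
    C (inverseLaplacian p φ.target (C' f)) = inverseLaplacian p φ.source f' := by
  have hφm := aemeasurable_restrict_source φ
  have hle := h.map_restrict_le hm hm0 hmt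
  obtain ⟨e, he⟩ := hsrc
  obtain ⟨e', he'⟩ := htgt
  set w : Xp p φ.target := e'.symm (C' f) with hw
  have hlw : laplacian p φ.target w = C' f := by
    rw [← he']
    exact e'.apply_symm_apply (C' f)
  obtain ⟨z, hz1, hz2⟩ := h.exists_comp_mem_Xp hp hm hm0 hmt hB₁ hB₂ w
  have hlz : laplacian p φ.source z = f' := by
    refine Lp.ext (hz2.trans ?_)
    have h1 := ae_comp_of_map_le hφm hle (hC' f)
    filter_upwards [h1, hf, ae_restrict_mem φ.open_source.measurableSet] with x hx1 hx2 hx3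
    rw [hlw, hx1, hx2, φ.left_inv hx3]
  have e1 : inverseLaplacian p φ.target (C' f) = inclusion p φ.target w := by
    rw [inverseLaplacian, ← he', inverse_equiv]
    rfl
  have e2 : inverseLaplacian p φ.source f' = inclusion p φ.source z := by
    rw [inverseLaplacian, ← hlz, ← he, inverse_equiv, ContinuousLinearMap.comp_apply]
    exact congrArg _ (e.symm_apply_apply z)
  rw [e1, e2]
  exact Lp.ext ((hC _).trans hz1.symm)

theorem enorm_sub_le_of_ae_eq_mul {Ω : Set Plane} {a : Plane → ℝ} {f f' : LpSpace p Ω}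
    (hf : f' =ᵐ[volume.restrict Ω] fun x => a x * f x) :
    ‖f - f'‖ₑ ≤ eLpNorm (fun x => 1 - a x) ∞ (volume.restrict Ω) * ‖f‖ₑ := by
  rw [Lp.enorm_def, Lp.enorm_def]
  refine le_of_eq_of_le (eLpNorm_congr_ae ?_)
    (eLpNorm_smul_le_eLpNorm_top_mul_eLpNorm p (Lp.aestronglyMeasurable f) fun x => 1 - a x)
  filter_upwards [Lp.coeFn_sub f f', hf] with x h1 h2
  rw [h1, Pi.sub_apply, h2, Pi.smul_apply', smul_eq_mul]
  ring

/-- The factor `|det Dφ|^{1/p}` from the change of variables and the bound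
`|1/|det Dφ| - 1| ≤ |1 - |det Dφ|| / |det Dφ|` combine to a power of `inf |det Dφ|`, because
`1/p - 1 ≤ 0`. -/
theorem CauchyRiemannOn.enorm_comp_symm_sub_le (h : CauchyRiemannOn s φ φ.source) (hp : p ≠ ⊤)
    {m : ℝ≥0∞} (hm : ∀ x ∈ φ.source, m ≤ ENNReal.ofReal (absJac φ x))
    {C' : LpSpace p φ.source →L[ℝ] LpSpace p φ.target} (hC' : IsCompositionOperator φ.symm C')
    {f g : LpSpace p φ.source}
    (hg : f =ᵐ[volume.restrict φ.source] fun x => absJac φ x * g x) :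
    ‖C' (g - f)‖ₑ ≤ m ^ ((1 - p.toReal) / p.toReal) *
      (eLpNorm (fun x => 1 - absJac φ x) ∞ (volume.restrict φ.source) * ‖f‖ₑ) := by
  set P := p.toReal with hP
  set N := eLpNorm (fun x => 1 - absJac φ x) ∞ (volume.restrict φ.source)
  have hp1 : 1 ≤ p := Fact.out
  have hp0 : p ≠ 0 := (zero_lt_one.trans_le hp1).ne'
  have hP1 : 1 ≤ P := by
    simpa using ENNReal.toReal_mono hp hp1
  have hP0 : 0 < P := by linarith
  have hpt : ∀ᵐ x ∂(volume.restrict φ.source),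
      ENNReal.ofReal (absJac φ x) * ‖(g - f : LpSpace p φ.source) x‖ₑ ^ P
        ≤ (m ^ (1 - P) * N ^ P) * ‖f x‖ₑ ^ P := by
    have hNae := ae_le_eLpNormEssSup (f := fun x => 1 - absJac φ x)
      (μ := volume.restrict φ.source)
    filter_upwards [hg, Lp.coeFn_sub g f, hNae, ae_restrict_mem φ.open_source.measurableSet]
      with x h1 h2 h3 hx
    have hJ := h.absJac_pos x hx
    set j := ENNReal.ofReal (absJac φ x) with hj
    have hj0 : j ≠ 0 := by simpa [hj] using hJ
    have hjt : j ≠ ⊤ := ENNReal.ofReal_ne_top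
    have e1 : (g - f : LpSpace p φ.source) x = (absJac φ x)⁻¹ * (1 - absJac φ x) * f x := by
      rw [h2, Pi.sub_apply, h1]
      field_simp
    have e2 : ‖(absJac φ x)⁻¹‖ₑ = j⁻¹ := by
      rw [enorm_inv hJ.ne', Real.enorm_of_nonneg hJ.le]
    rw [← eLpNorm_exponent_top] at h3
    calc j * ‖(g - f : LpSpace p φ.source) x‖ₑ ^ P
        = (j * j⁻¹ ^ P) * ‖1 - absJac φ x‖ₑ ^ P * ‖f x‖ₑ ^ P := by
          rw [e1, enorm_mul, enorm_mul, e2, ENNReal.mul_rpow_of_nonneg _ _ hP0.le,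
            ENNReal.mul_rpow_of_nonneg _ _ hP0.le]
          ring
      _ = j ^ (1 - P) * ‖1 - absJac φ x‖ₑ ^ P * ‖f x‖ₑ ^ P := by
          rw [ENNReal.inv_rpow, ← ENNReal.rpow_neg, show 1 - P = 1 + -P from sub_eq_add_neg _ _,
            ENNReal.rpow_add _ _ hj0 hjt, ENNReal.rpow_one]
      _ ≤ (m ^ (1 - P) * N ^ P) * ‖f x‖ₑ ^ P := by
          gcongr ?_ * ?_ * _
          · rw [show 1 - P = -(P - 1) by ring, ENNReal.rpow_neg, ENNReal.rpow_neg,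
              ENNReal.inv_le_inv]
            exact ENNReal.rpow_le_rpow (hm x hx) (by linarith)
          · exact ENNReal.rpow_le_rpow h3 hP0.le
  have hint : ∫⁻ y in φ.target, ‖C' (g - f) y‖ₑ ^ P
      ≤ (m ^ (1 - P) * N ^ P) * ∫⁻ x in φ.source, ‖f x‖ₑ ^ P := by
    have e1 : ∫⁻ y in φ.target, ‖C' (g - f) y‖ₑ ^ P
        = ∫⁻ y in φ.target, ‖(g - f : LpSpace p φ.source) (φ.symm y)‖ₑ ^ P :=
      lintegral_congr_ae ((hC' (g - f)).mono fun y hy => by simp only [hy])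
    rw [e1, ← φ.image_source_eq_target,
      h.setLIntegral_target φ.open_source.measurableSet subset_rfl,
      ← lintegral_const_mul'' _ ((Lp.aestronglyMeasurable f).enorm.pow_const P)]
    refine lintegral_mono_ae ?_
    filter_upwards [hpt, ae_restrict_mem φ.open_source.measurableSet] with x hx hxs
    rwa [φ.left_inv hxs]
  rw [Lp.enorm_def, Lp.enorm_def, eLpNorm_eq_lintegral_rpow_enorm_toReal hp0 hp,
    eLpNorm_eq_lintegral_rpow_enorm_toReal hp0 hp, ← hP]
  refine (ENNReal.rpow_le_rpow hint (by positivity)).trans_eq ?_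
  rw [ENNReal.mul_rpow_of_nonneg _ _ (by positivity),
    ENNReal.mul_rpow_of_nonneg _ _ (by positivity),
    ← ENNReal.rpow_mul, ← ENNReal.rpow_mul, mul_one_div, mul_one_div, div_self hP0.ne',
    ENNReal.rpow_one, mul_assoc]

/-- Both forms of the estimate, with the operator norm of the inverse Laplacian on the target or
on the source as the constant. -/
theorem IsAdmissible.exists_operators_bounds (hadm : IsAdmissible p φ.source φ φ.target)
    (hp : p ≠ ⊤) (hconn : IsConnected φ.source) (hc : ∀ x ∈ φ.source, ConformalAt φ x) :
    ∃ (C : LpSpace p φ.target →L[ℝ] LpSpace p φ.source)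
      (C' : LpSpace p φ.source →L[ℝ] LpSpace p φ.target),
      IsCompositionOperator φ C ∧ IsCompositionOperator φ.symm C' ∧
      (⨅ x ∈ φ.source, ENNReal.ofReal (absJac φ x)) ≠ 0 ∧
      ‖inverseLaplacian p φ.source - C ∘L inverseLaplacian p φ.target ∘L C'‖ₑ
        ≤ ‖inverseLaplacian p φ.target‖ₑ *
          (eLpNorm (fun x => 1 - absJac φ x) ∞ (volume.restrict φ.source) /
            ⨅ x ∈ φ.source, ENNReal.ofReal (absJac φ x)) ∧
      ‖inverseLaplacian p φ.source - C ∘L inverseLaplacian p φ.target ∘L C'‖ₑ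
        ≤ ‖inverseLaplacian p φ.source‖ₑ *
          eLpNorm (fun x => 1 - absJac φ x) ∞ (volume.restrict φ.source) := by
  obtain ⟨s, c, B, hs, hc0, hB0, hcJ, hJB, hB₁, hB₂⟩ :=
    hadm.exists_cauchyRiemannOn_bounds hconn.isPreconnected hc
  have hΩ := φ.open_source
  set m : ℝ≥0∞ := ⨅ x ∈ φ.source, ENNReal.ofReal (absJac φ x)
  set N := eLpNorm (fun x => 1 - absJac φ x) ∞ (volume.restrict φ.source)
  have hm : ∀ x ∈ φ.source, m ≤ ENNReal.ofReal (absJac φ x) := fun x hx => iInf₂_le x hx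
  have hm0 : m ≠ 0 := by
    have h1 : ENNReal.ofReal c ≤ m := le_iInf₂ fun x hx => ENNReal.ofReal_le_ofReal (hcJ x hx)
    exact ((ENNReal.ofReal_pos.2 hc0).trans_le h1).ne'
  have hmt : m ≠ ⊤ := by
    obtain ⟨x, hx⟩ := hconn.nonempty
    exact ((hm x hx).trans_lt ENNReal.ofReal_lt_top).ne
  obtain ⟨C, hC, hCb⟩ := exists_compositionOperator (p := p) hp (ENNReal.inv_ne_top.2 hm0)
    (aemeasurable_restrict_source φ) (hs.map_restrict_le hm hm0 hmt)
  have hB' : ENNReal.ofReal B⁻¹ ≠ 0 := by simpa using hB0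
  have hsymm : ∀ y ∈ φ.symm.source, ENNReal.ofReal B⁻¹ ≤ ENNReal.ofReal (absJac φ.symm y) := by
    intro y hy
    refine ENNReal.ofReal_le_ofReal ?_
    have hx := φ.map_target hy
    have h1 := hs.absJac_symm_mul hx
    rw [φ.right_inv hy] at h1
    rw [eq_inv_of_mul_eq_one_left h1]
    exact inv_anti₀ (hs.absJac_pos _ hx) (hJB _ hx)
  obtain ⟨C', hC', -⟩ := exists_compositionOperator (p := p) (Ω := φ.target) (Ω' := φ.source) hp
    (ENNReal.inv_ne_top.2 hB') (aemeasurable_restrict_source φ.symm)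
    (CauchyRiemannOn.map_restrict_le (φ := φ.symm) hs.symm hsymm hB' ENNReal.ofReal_ne_top)
  have hJmeas := (hs.continuousOn_absJac hΩ).aestronglyMeasurable (μ := volume) hΩ.measurableSet
  obtain ⟨M, hM⟩ := exists_multiplicationOperator (p := p) (B := B) hJmeas (by
    filter_upwards [ae_restrict_mem hΩ.measurableSet] with x hx
    rw [Real.norm_of_nonneg (hs.absJac_pos x hx).le]
    exact hJB x hx)
  obtain ⟨M', hM'⟩ := exists_multiplicationOperator (p := p) (Ω := φ.source) (B := c⁻¹)
    (a := fun x => (absJac φ x)⁻¹)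
    (((hs.continuousOn_absJac hΩ).inv₀ fun x hx =>
      (hs.absJac_pos x hx).ne').aestronglyMeasurable hΩ.measurableSet) (by
    filter_upwards [ae_restrict_mem hΩ.measurableSet] with x hx
    rw [Real.norm_of_nonneg (inv_nonneg.2 (hs.absJac_pos x hx).le)]
    exact inv_anti₀ hc0 (hcJ x hx))
  have key : ∀ {f f' : LpSpace p φ.source},
      (f' =ᵐ[volume.restrict φ.source] fun x => absJac φ x * f x) →
      C (inverseLaplacian p φ.target (C' f)) = inverseLaplacian p φ.source f' := fun hf =>
    hs.comp_inverseLaplacian_comp hp hm hm0 hmt hB₁ hB₂ hadm.invertible_source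
      hadm.invertible_target hC hC' hf
  refine ⟨C, C', hC, hC', hm0, opENorm_le_bound _ fun f => ?_, opENorm_le_bound _ fun f => ?_⟩
  · -- apply the transfer identity to `f / |det Dφ|` to express `T f` through the target
    have hg : f =ᵐ[volume.restrict φ.source] fun x => absJac φ x * M' f x := by
      filter_upwards [hM' f, ae_restrict_mem hΩ.measurableSet] with x hx hxs
      rw [hx, mul_inv_cancel_left₀ (hs.absJac_pos x hxs).ne']
    have e : (inverseLaplacian p φ.source - C ∘L inverseLaplacian p φ.target ∘L C') f
        = C (inverseLaplacian p φ.target (C' (M' f - f))) := by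
      simp only [_root_.sub_apply, ContinuousLinearMap.comp_apply, map_sub, key hg]
    -- `m⁻¹ ^ (1 / p)` from `C` and `m ^ ((1 - p) / p)` from `C'` multiply to `m⁻¹`
    have hpow : m⁻¹ ^ (1 / p).toReal * m ^ ((1 - p.toReal) / p.toReal) = m⁻¹ := by
      have hp1 : 1 ≤ p.toReal := by
        simpa using ENNReal.toReal_mono hp (Fact.out : 1 ≤ p)
      rw [ENNReal.inv_rpow, ← ENNReal.rpow_neg, ← ENNReal.rpow_add _ _ hm0 hmt,
        ← ENNReal.rpow_neg_one]
      congr 1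
      rw [ENNReal.toReal_div, ENNReal.toReal_one]
      field_simp
      ring
    rw [e]
    calc ‖C (inverseLaplacian p φ.target (C' (M' f - f)))‖ₑ
        ≤ m⁻¹ ^ (1 / p).toReal * (‖inverseLaplacian p φ.target‖ₑ *
          (m ^ ((1 - p.toReal) / p.toReal) * (N * ‖f‖ₑ))) := by
          refine (hCb _).trans (mul_le_mul_right (le_opENorm_of_le _ ?_) _)
          exact hs.enorm_comp_symm_sub_le hp hm hC' hg
      _ = ‖inverseLaplacian p φ.target‖ₑ *
          ((m⁻¹ ^ (1 / p).toReal * m ^ ((1 - p.toReal) / p.toReal)) * N) * ‖f‖ₑ := by ring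
      _ = ‖inverseLaplacian p φ.target‖ₑ * (N / m) * ‖f‖ₑ := by
          rw [hpow, ENNReal.div_eq_inv_mul]
  · have e : (inverseLaplacian p φ.source - C ∘L inverseLaplacian p φ.target ∘L C') f
        = inverseLaplacian p φ.source (f - M f) := by
      simp only [_root_.sub_apply, ContinuousLinearMap.comp_apply, map_sub,
        key (hM f)]
    rw [e, mul_assoc]
    exact le_opENorm_of_le _ (enorm_sub_le_of_ae_eq_mul (hM f))

end Comparison

end PlaneDomain

end

theorem mainTheorem5 (p : ℝ≥0∞) [Fact (1 ≤ p)] (hp1 : 1 < p) (hp2 : p < ⊤) :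
    (∀ Ω' : Set PlaneDomain.Plane, ∃ C : ℝ≥0, 0 < C ∧
      ∀ (Ω : Set PlaneDomain.Plane)
        (φ : OpenPartialHomeomorph PlaneDomain.Plane PlaneDomain.Plane),
        IsConnected Ω → Bornology.IsBounded Ω → PlaneDomain.IsAdmissible p Ω φ Ω' →
        (∀ x ∈ Ω, ConformalAt φ x) →
        PlaneDomain.InverseLaplacianBound p Ω φ Ω' C) ∧
    (∀ (Ω : Set PlaneDomain.Plane) (M : ℝ≥0), IsConnected Ω → Bornology.IsBounded Ω →
      ∃ C : ℝ≥0, 0 < C ∧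
      ∀ (Ω' : Set PlaneDomain.Plane)
        (φ : OpenPartialHomeomorph PlaneDomain.Plane PlaneDomain.Plane),
        PlaneDomain.IsAdmissible p Ω φ Ω' →
        (∀ x ∈ Ω, ConformalAt φ x) →
        (⨅ x ∈ Ω, ENNReal.ofReal (PlaneDomain.absJac φ x)) ≤ M →
        PlaneDomain.InverseLaplacianBound p Ω φ Ω' C) := by
  refine ⟨fun Ω' => ⟨‖PlaneDomain.inverseLaplacian p Ω'‖₊ + 1, by positivity, ?_⟩,
    fun Ω M hconn _ => ⟨‖PlaneDomain.inverseLaplacian p Ω‖₊ * M + 1, by positivity, ?_⟩⟩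
  · intro Ω φ hconn _ hadm hc
    obtain rfl := hadm.source_eq
    obtain rfl := hadm.target_eq
    obtain ⟨C, C', hC, hC', -, hb, -⟩ := hadm.exists_operators_bounds hp2.ne hconn hc
    refine ⟨C, C', hC, hC', hb.trans (mul_le_mul_left ?_ _)⟩
    rw [enorm_eq_nnnorm]
    exact_mod_cast le_self_add
  · intro Ω' φ hadm hc hM
    obtain rfl := hadm.source_eq
    obtain rfl := hadm.target_eq
    obtain ⟨C, C', hC, hC', hm0, -, hb⟩ := hadm.exists_operators_bounds hp2.ne hconn hc
    refine ⟨C, C', hC, hC', hb.trans ?_⟩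
    set N := eLpNorm (fun x => 1 - PlaneDomain.absJac φ x) ∞ (volume.restrict φ.source)
    set m : ℝ≥0∞ := ⨅ x ∈ φ.source, ENNReal.ofReal (PlaneDomain.absJac φ x)
    have hmt : m ≠ ⊤ := (hM.trans_lt ENNReal.coe_lt_top).ne
    have hNm : N ≤ M * (N / m) := by
      rw [← mul_div_assoc, ENNReal.le_div_iff_mul_le (.inl hm0) (.inl hmt), mul_comm]
      exact mul_le_mul_left hM N
    calc _ ≤ ‖PlaneDomain.inverseLaplacian p φ.source‖ₑ * (M * (N / m)) :=
          mul_le_mul_right hNm _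
      _ = (‖PlaneDomain.inverseLaplacian p φ.source‖ₑ * M) * (N / m) := by rw [mul_assoc]
      _ ≤ _ := by
          refine mul_le_mul_left ?_ _
          rw [enorm_eq_nnnorm]
          exact_mod_cast le_self_add
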